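/- **Model.** Let $G=(V,E)$ be a finite simple graph. Each vertex $v$ has a buffer of size $B_v\in\mathbb N$, an entanglement arrival probability $\lambda_v\in(0,1)$ and a decoherence probability $\mu_v\in(0,1)$. For a vertex $v$ let $\delta(v)$ be the set of edges incident to $v$. At the beginning of slot $t=0,1,\dots$ vertex $v$ stores $L_v(t)\in\{0,\dots,B_v\}$ entanglements and edge $e$ has $R_e(t)\in\mathbb N$ waiting requests; the initial state is arbitrary. In slot $t$ a matching $M(t)\subseteq E$ is scheduled, and $S_e(t)=1$ if $e=(u,v)\in M(t)$, $R_e(t)>0$, $L_u(t)>0$ and $L_v(t)>0$, while $S_e(t)=0$ otherwise. Then $$R_e(t+1)=R_e(t)-S_e(t)+A_e(t),\qquad L_v(t+1)=\min\Big(B_v,\;L_v(t)-\sum_{e\in\delta(v)}S_e(t)-D_v(t)+Y_v(t)\Big).$$ Given the past and the schedule, $D_v(t)\sim\mathrm{Binom}(L_v(t)-\sum_{e\in\delta(v)}S_e(t),\mu_v)$ and $Y_v(t)\sim\mathrm{Bernoulli}(\lambda_v)$ for $v\in V$, together with the request arrival vector $A(t)\in\mathbb N^E$, are independent; the vectors $A(t)$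 are identically distributed over $t$, with $\mathbb E[A_e(t)]=\nu_e$ and $\mathrm{Var}(A_e(t))=\sigma_e^2<\infty$. **Algorithm with frame length $T$.** At each time $kT$, $k=0,1,2,\dots$, take an optimal solution $x^*$ of the linear program $$\max\sum_{e\in E}R_e(kT)\,x_e\quad\text{s.t.}\quad \sum_{e\in\delta(v)}x_e\le\lambda_v\ \ (v\in V),\qquad \sum_{e\in E(S)}x_e\le\tfrac{|S|-1}{2}\ \ (S\subseteq V,\ |S|\ge 3\text{ odd}),\qquad x_e\ge0\ \ (e\in E),$$ where $E(S)$ is the set of edges with both ends in $S$, and probabilities $(p_M)$ on the matchings of $G$ with $\sum_{M\ni e}p_M=x^*_e$ for all $e\in E$; both are determined by $R(kT)$ through a fixed rule. In each of the slots $kT,\dots,kT+T-1$ the schedule $M(t)$ has distribution $(p_M)$, given the past. **Coherence factor.** For $v\in V$ consider the reference Markov chain on $\{0,\dots,B_v\}$ in which, in each slot, one entanglement is removed with probability $\lambda_v$ if there is one, each remaining entanglement is lost independently with probability $\mu_v$, and then one entanglement arrives with probability $\lambda_v$, the content being truncated at $B_v$. Let $\pi^{(v)}$ be its stationary distribution,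 $C_v=1-\pi^{(v)}_0$, and $\Gamma_{\mathrm{coh}}=\min_{e=(u,v)\in E}(C_u+C_v-1)^+$. **Capacity region.** A request-agnostic policy $\pi$ selects the matching $M$ with probability $\pi(M\mid\mathbf L)$ when the entanglement queues are in state $\mathbf L$ (here service on a scheduled edge requires only an entanglement at each of its two ends); let $d_\pi$ be the stationary distribution of the entanglement queues under $\pi$. Let $\mathcal C$ be the set of vectors $\nu$ for which there is a request-agnostic policy $\pi$ with $\nu_e<\sum_{\mathbf L:\,L_u>0,\,L_v>0}\sum_{M\ni e}\pi(M\mid\mathbf L)\,d_\pi(\mathbf L)$ for every edge $e=(u,v)\in E$. **Theorem 1.** Let $\epsilon>0$, suppose that $\Gamma_{\mathrm{coh}}>0$ (in particular $E\neq\emptyset$) and that $\frac{1+\epsilon}{\Gamma_{\mathrm{coh}}}\nu\in\mathcal C$, and let $\mathcal V(\mathbf R)=\frac12\sum_{e\in E}R_e^2$. Then there exist an integer $T_\epsilon>0$, a real $\delta>0$ and a finite set $\mathcal B\subset\mathbb N^E$, depending only on the graph, on $(B_v,\lambda_v,\mu_v)_{v\in V}$, on $(\nu_e,\sigma_e)_{e\in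 E}$ and on $\epsilon$, such that for every run of the algorithm with frame length $T_\epsilon$ and every $k\in\{0,1,2,\dots\}$, $$\mathbb E\big[\mathcal V(\mathbf R((k+1)T_\epsilon))-\mathcal V(\mathbf R(kT_\epsilon))\,\big|\,\mathbf L(kT_\epsilon),\mathbf R(kT_\epsilon)\big]\le-\delta\qquad\text{whenever }\mathbf R(kT_\epsilon)\notin\mathcal B,$$ where the conditional expectation given a state that has positive probability exists, that is, the increment is integrable. -/

import Mathlib

open MeasureTheory ProbabilityTheory

noncomputable section

/-- The data of a quantum switch: a simple graph `G` whose vertices are the quantum memories and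
whose edges are the user pairs; at each vertex a buffer size, a Bernoulli entanglement arrival
probability `lam v` and a per-slot decoherence probability `mu v`, both in `(0, 1)`. -/
structure QSwitch (V : Type*) where
  G : SimpleGraph V
  buf : V → ℕ
  lam : V → ℝ
  mu : V → ℝ
  lam_pos : ∀ v, 0 < lam v
  lam_lt_one : ∀ v, lam v < 1
  mu_pos : ∀ v, 0 < mu v
  mu_lt_one : ∀ v, mu v < 1

/-- `d` is a stationary probability vector of the finite transition matrix `K`. -/
def IsStationaryVec {ι : Type*} [Fintype ι] (K : ι → ι → ℝ) (d : ι → ℝ) : Prop :=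
  (∀ i, 0 ≤ d i) ∧ ∑ i, d i = 1 ∧ ∀ j, ∑ i, d i * K i j = d j

/-- Bernoulli weights. -/
def bernWt (p : ℝ) (a : Bool) : ℝ := if a then p else 1 - p

/-- Binomial weights: `P(Binom(n, p) = k)`; it is `0` for `k > n`. -/
def binomWt (n : ℕ) (p : ℝ) (k : ℕ) : ℝ := (n.choose k : ℝ) * p ^ k * (1 - p) ^ (n - k)

namespace QSwitch

variable {V : Type*}

/-- The edges of the switch. -/
abbrev Edge (s : QSwitch V) : Type _ := {e : Sym2 V // e ∈ s.G.edgeSet}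

/-- Entanglement queue vectors `L ∈ ∏ v, {0, …, B_v}`. -/
abbrev LState (s : QSwitch V) : Type _ := (v : V) → Fin (s.buf v + 1)

/-- Request queue vectors `R ∈ ℕ^E`. -/
abbrev RState (s : QSwitch V) : Type _ := s.Edge → ℕ

/-- Matchings: sets of edges no two of which share a vertex. -/
abbrev Matching (s : QSwitch V) : Type _ :=
  {m : Finset s.Edge // ∀ e ∈ m, ∀ f ∈ m, e ≠ f → ∀ v : V, ¬ (v ∈ e.1 ∧ v ∈ f.1)}

variable [Fintype V]

instance instFintypeEdge (s : QSwitch V) : Fintype s.Edge := Fintype.ofFinite _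

instance instFintypeLState (s : QSwitch V) : Fintype s.LState := Fintype.ofFinite _

instance instFintypeMatching (s : QSwitch V) : Fintype s.Matching := Fintype.ofFinite _

/-! ### Dynamics of the entanglement buffers -/

/-- Probability that a buffer at `v` holding `n` entanglements after service holds `j`
entanglements at the start of the next slot: each of the `n` survives with probability `1 - mu v`,
then one arrives with probability `lam v`, and the content is truncated at the buffer size. -/
def nodeKernel (s : QSwitch V) (v : V) (n j : ℕ) : ℝ :=
  ∑ a : Bool, ∑ k ∈ Finset.range (n + 1),
    bernWt (s.lam v) a * binomWt n (1 - s.mu v) k *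
      (if j = min (s.buf v) (k + a.toNat) then 1 else 0)

/-- Transition matrix of the reference chain at `v`, on `{0, …, B_v}`: a service attempt with
probability `lam v`, then decoherence, then arrival. -/
def refKernel (s : QSwitch V) (v : V) (i j : Fin (s.buf v + 1)) : ℝ :=
  ∑ a : Bool, bernWt (s.lam v) a * s.nodeKernel v ((i : ℕ) - a.toNat) j

/-- The stationary distribution of the reference chain. -/
def refStationary (s : QSwitch V) (v : V) : Fin (s.buf v + 1) → ℝ :=
  Classical.epsilon (IsStationaryVec (s.refKernel v))

/-- The availability `C_v = 1 - π_0`. -/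
def avail (s : QSwitch V) (v : V) : ℝ := 1 - s.refStationary v 0

/-- The coherence factor: the minimum of `(C_u + C_v - 1)^+` over the edges `(u, v)`. -/
def cohFactor (s : QSwitch V) : ℝ :=
  ⨅ d : s.G.Dart, max (s.avail d.fst + s.avail d.snd - 1) 0

open Classical in
/-- The number of edges in the edge set `F` that are incident to `v`. -/
def incidentCount (s : QSwitch V) (F : Finset s.Edge) (v : V) : ℕ :=
  (F.filter (fun e => v ∈ e.1)).card

open Classical in
/-- The scheduled edges with an entanglement available at both ends. -/
def potentialServed (s : QSwitch V) (m : s.Matching) (l : s.LState) : Finset s.Edge :=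
  {e ∈ m.1 | ∀ v ∈ e.1, 0 < (l v : ℕ)}

open Classical in
/-- The edges actually served: scheduled, with an entanglement available at both ends and a
waiting request. -/
def served (s : QSwitch V) (m : s.Matching) (l : s.LState) (r : s.RState) : Finset s.Edge :=
  {e ∈ s.potentialServed m l | 0 < r e}

/-! ### The capacity region -/

/-- A request-agnostic policy: it selects the matching `m` with probability `pol l m` when the
entanglement queues are in state `l`. -/
def IsPolicy (s : QSwitch V) (pol : s.LState → s.Matching → ℝ) : Prop :=
  ∀ l, (∀ m, 0 ≤ pol l m) ∧ ∑ m, pol l m = 1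

/-- Transition matrix of the entanglement queues under a request-agnostic policy (the request
queues do not restrict service). -/
def polKernel (s : QSwitch V) (pol : s.LState → s.Matching → ℝ) (l l' : s.LState) : ℝ :=
  ∑ m, pol l m *
    ∏ v, s.nodeKernel v ((l v : ℕ) - s.incidentCount (s.potentialServed m l) v) (l' v)

open Classical in
/-- The capacity region. -/
def capacity (s : QSwitch V) : Set (s.Edge → ℝ) :=
  {ν | ∃ (pol : s.LState → s.Matching → ℝ) (d : s.LState → ℝ),
    s.IsPolicy pol ∧ IsStationaryVec (s.polKernel pol) d ∧
    ∀ e : s.Edge, ν e < ∑ l : s.LState with (∀ v ∈ e.1, 0 < (l v : ℕ)),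
      ∑ m : s.Matching with e ∈ m.1, pol l m * d l}

/-! ### The scheduling algorithm -/

open Classical in
/-- Feasible points of the linear program: degree constraints, blossom constraints and
nonnegativity. -/
def LPFeasible (s : QSwitch V) (x : s.Edge → ℝ) : Prop :=
  (∀ v : V, ∑ e : s.Edge with v ∈ e.1, x e ≤ s.lam v) ∧
  (∀ S : Finset V, Odd S.card → 3 ≤ S.card →
    ∑ e : s.Edge with (∀ v ∈ e.1, v ∈ S), x e ≤ ((S.card : ℝ) - 1) / 2) ∧
  (∀ e, 0 ≤ x e)

/-- Optimal solutions of the linear program with weights `w`. -/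
def LPOptimal (s : QSwitch V) (w : s.Edge → ℝ) (x : s.Edge → ℝ) : Prop :=
  s.LPFeasible x ∧ ∀ y, s.LPFeasible y → ∑ e, w e * y e ≤ ∑ e, w e * x e

open Classical in
/-- `p` is a matching distribution that decomposes the edge vector `x`. -/
def IsDecomposition (s : QSwitch V) (p : s.Matching → ℝ) (x : s.Edge → ℝ) : Prop :=
  (∀ m, 0 ≤ p m) ∧ ∑ m, p m = 1 ∧ ∀ e : s.Edge, ∑ m : s.Matching with e ∈ m.1, p m = x e

/-- A rule of the algorithm: it assigns to each request queue vector `r` a matching distribution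
that decomposes an optimal solution of the linear program with weights `r`. -/
def IsLPRule (s : QSwitch V) (p : s.RState → s.Matching → ℝ) : Prop :=
  ∀ r : s.RState, ∃ x : s.Edge → ℝ,
    s.LPOptimal (fun e => (r e : ℝ)) x ∧ s.IsDecomposition (p r) x

/-! ### The switch process -/

/-- The common law of the request arrival vectors `(A_e(t))_e`: mean `ν e` and variance `σ e ^ 2`
at each edge. -/
structure IsArrivalLaw (s : QSwitch V) (law : Measure s.RState) (ν σ : s.Edge → ℝ) : Prop where
  isProbabilityMeasure : IsProbabilityMeasure law
  memLp : ∀ e, MemLp (fun a : s.RState => (a e : ℝ)) 2 law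
  mean : ∀ e, ∫ a, (a e : ℝ) ∂law = ν e
  variance : ∀ e, variance (fun a : s.RState => (a e : ℝ)) law = σ e ^ 2

/-- What happens in one slot: the schedule, the numbers of decohered entanglements, the
entanglement arrivals and the request arrivals. -/
structure Slot (s : QSwitch V) where
  M : s.Matching
  D : V → ℕ
  Y : V → Bool
  A : s.RState

/-- The probability of the slot outcome `x` when the matching distribution in force is `p` and
the queues are `(l, r)`: the schedule has law `p`; given the schedule, the `D v` are
`Binom(l v - (services at v), mu v)`, the `Y v` are `Bernoulli(lam v)`, the request arrivals have
law `law`, and all of these are independent. -/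
def slotWt (s : QSwitch V) (law : Measure s.RState) (p : s.Matching → ℝ)
    (l : s.LState) (r : s.RState) (x : s.Slot) : ℝ :=
  p x.M *
    (∏ v, binomWt ((l v : ℕ) - s.incidentCount (s.served x.M l r) v) (s.mu v) (x.D v)) *
    (∏ v, bernWt (s.lam v) (x.Y v)) * law.real {x.A}

open Classical in
/-- `(L, R)` are the queues of the switch operated with frames of length `T`: in the slots
`kT, …, kT + T - 1` the schedules are drawn from the matching distribution `p (R (kT))`.
`X t` is the outcome of slot `t`. The initial state is arbitrary. -/
structure IsSwitchRun (s : QSwitch V) (law : Measure s.RState)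
    (p : s.RState → s.Matching → ℝ) (T : ℕ)
    {Ω : Type*} [MeasurableSpace Ω] (P : Measure Ω)
    (L : ℕ → Ω → s.LState) (R : ℕ → Ω → s.RState) (X : ℕ → Ω → s.Slot) : Prop where
  measurable_L : ∀ t l, MeasurableSet {ω | L t ω = l}
  measurable_R : ∀ t r, MeasurableSet {ω | R t ω = r}
  measurable_X : ∀ t x, MeasurableSet {ω | X t ω = x}
  /-- evolution of the request queues -/
  R_succ : ∀ t ω e, R (t + 1) ω e =
    R t ω e - (if e ∈ s.served (X t ω).M (L t ω) (R t ω) then 1 else 0) + (X t ω).A e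
  /-- evolution of the entanglement queues -/
  L_succ : ∀ t ω v, (L (t + 1) ω v : ℕ) =
    min (s.buf v)
      ((L t ω v : ℕ) - s.incidentCount (s.served (X t ω).M (L t ω) (R t ω)) v
        - (X t ω).D v + ((X t ω).Y v).toNat)
  /-- conditional law of slot `t` given the whole past -/
  law_slot : ∀ (t : ℕ) (l : ℕ → s.LState) (r : ℕ → s.RState) (x : ℕ → s.Slot),
    P.real {ω | (∀ i ≤ t, L i ω = l i ∧ R i ω = r i) ∧ ∀ i < t + 1, X i ω = x i} =
      P.real {ω | (∀ i ≤ t, L i ω = l i ∧ R i ω = r i) ∧ ∀ i < t, X i ω = x i} *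
        s.slotWt law (p (r (T * (t / T)))) (l t) (r t) (x t)

/-- The quadratic Lyapunov function. -/
def lyap (s : QSwitch V) (r : s.RState) : ℝ := (1 / 2) * ∑ e, (r e : ℝ) ^ 2

end QSwitch

end

noncomputable section

/-! The proof is a frame-based quadratic Lyapunov argument with three ingredients.

Polytope bound. In stationarity a request-agnostic policy serves a node no faster than entanglements
arrive there, and every set of served edges is a matching. Its service rates are therefore feasible
for the linear program (`lpFeasible_serviceRate`), so the capacity hypothesis yields a feasible `y`
strictly above `(1 + ε) / Γ • ν`.

Availability. Within a frame the matching law is frozen and covers each node `v` with probability at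
most `lam v`, the removal rate of the reference chain. For monotone test functions the true buffer
thus dominates the reference chain (`refStep_le_slotMean`, `ofReal_refPos_le_lintegral`). That chain
forgets its start geometrically, because from any state it can empty in one slot (`refPos_osc`).
Hence `v` is nonempty in slot `j` of a frame with probability at least `avail v` minus a geometric
term, and a union bound over the two ends of an edge gives `Γ` minus a summable error
(`cohFactor_sub_le_real`). The schedule is drawn independently of the current buffers given the
past, so an edge with at least `T` waiting requests receives expected service at least `x e * (T * Γ
- transient)` over a frame (`le_integral_sum_service`).

Drift. With `c = Γ / (1 + ε) < Γ`, a long frame absorbs the transient, and the drift is at most `T *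
(∑ r ν - c * ∑ r x)` plus a constant. Optimality of `x` against `y` makes this at most a constant
minus a positive multiple of `∑ r`, which is below `-1` for all but finitely many `r`. -/

/-- A stochastic matrix on a finite nonempty index set has a stationary probability vector. -/
theorem exists_isStationaryVec {ι : Type*} [Fintype ι] [Nonempty ι] (K : ι → ι → ℝ)
    (h0 : ∀ i j, 0 ≤ K i j) (h1 : ∀ i, ∑ j, K i j = 1) : ∃ d, IsStationaryVec K d := by
  classical
  -- Row sums equal to 1 put the constant vector in the kernel of `K - 1`; singularity then also
  -- gives a left null vector.
  have hdet : (Matrix.of K - 1).det = 0 := by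
    rw [← Matrix.exists_mulVec_eq_zero_iff]
    refine ⟨fun _ => 1, fun h => ?_, ?_⟩
    · obtain ⟨i⟩ := ‹Nonempty ι›
      exact one_ne_zero (congrFun h i)
    · funext i
      simp [Matrix.mulVec, dotProduct, h1, Matrix.one_apply]
  obtain ⟨v, hv0, hv⟩ := Matrix.exists_vecMul_eq_zero_iff.2 hdet
  have hvK : ∀ j, ∑ i, v i * K i j = v j := by
    intro j
    have := congrFun hv j
    rw [Matrix.vecMul_sub, Matrix.vecMul_one] at this
    simpa [Matrix.vecMul, dotProduct, sub_eq_zero] using this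
  -- The left null vector may change sign. The triangle inequality gives `|v| ≤ |v| K` entrywise,
  -- and both sides have the same total, so `|v|` is itself invariant.
  have hle : ∀ j ∈ Finset.univ, |v j| ≤ ∑ i, |v i| * K i j := by
    intro j _
    calc |v j| = |∑ i, v i * K i j| := by rw [hvK]
      _ ≤ ∑ i, |v i * K i j| := Finset.abs_sum_le_sum_abs _ _
      _ = _ := by simp [abs_mul, abs_of_nonneg (h0 _ _)]
  have htot : ∑ j, |v j| = ∑ j, ∑ i, |v i| * K i j := by
    rw [Finset.sum_comm]
    simp [← Finset.mul_sum, h1]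
  have heq := (Finset.sum_eq_sum_iff_of_le hle).1 htot
  have hpos : 0 < ∑ j, |v j| := by
    obtain ⟨j, hj⟩ := Function.ne_iff.1 hv0
    exact Finset.sum_pos' (fun _ _ => abs_nonneg _) ⟨j, Finset.mem_univ _, abs_pos.2 hj⟩
  refine ⟨fun i => |v i| / ∑ j, |v j|, fun i => by positivity, ?_, fun j => ?_⟩
  · rw [← Finset.sum_div, div_self hpos.ne']
  · simp only [div_mul_eq_mul_div]
    rw [← Finset.sum_div, ← heq j (Finset.mem_univ _)]

/-! ### Binomial and Bernoulli means -/

theorem binomWt_nonneg (n : ℕ) {p : ℝ} (h0 : 0 ≤ p) (h1 : p ≤ 1) (k : ℕ) : 0 ≤ binomWt n p k := by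
  have : 0 ≤ 1 - p := by linarith
  unfold binomWt
  positivity

theorem bernWt_nonneg {p : ℝ} (h0 : 0 ≤ p) (h1 : p ≤ 1) (a : Bool) : 0 ≤ bernWt p a := by
  unfold bernWt
  split_ifs <;> linarith

theorem sum_bernWt (p : ℝ) : ∑ a, bernWt p a = 1 := by simp [bernWt]

theorem sum_binomWt (n : ℕ) (p : ℝ) : ∑ k ∈ Finset.range (n + 1), binomWt n p k = 1 := by
  have := add_pow p (1 - p) n
  rw [add_sub_cancel, one_pow] at this
  rw [this]
  exact Finset.sum_congr rfl fun k _ => by unfold binomWt; ring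

theorem binomWt_eq_zero {n k : ℕ} (p : ℝ) (h : n < k) : binomWt n p k = 0 := by
  simp [binomWt, Nat.choose_eq_zero_of_lt h]

theorem binomWt_reflect {n k : ℕ} (p : ℝ) (h : k ≤ n) :
    binomWt n (1 - p) (n - k) = binomWt n p k := by
  simp only [binomWt, Nat.choose_symm h, sub_sub_cancel, Nat.sub_sub_self h]
  ring

/-- The expectation of `g` under the binomial weights. -/
def binomMean (n : ℕ) (p : ℝ) (g : ℕ → ℝ) : ℝ := ∑ k ∈ Finset.range (n + 1), binomWt n p k * g k

theorem binomMean_eq_antidiagonal (n : ℕ) (p : ℝ) (g : ℕ → ℝ) :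
    binomMean n p g = ∑ ij ∈ Finset.HasAntidiagonal.antidiagonal n,
      (n.choose ij.1 : ℝ) * (p ^ ij.1 * (1 - p) ^ ij.2 * g ij.1) := by
  rw [Finset.Nat.sum_antidiagonal_eq_sum_range_succ
    (fun i j => (n.choose i : ℝ) * (p ^ i * (1 - p) ^ j * g i))]
  exact Finset.sum_congr rfl fun k _ => by unfold binomWt; ring

/-- Conditioning on one of the `n + 1` trials, which is Pascal's rule; it replaces a coupling in the
proof of monotonicity in `n`. -/
theorem binomMean_succ (n : ℕ) (p : ℝ) (g : ℕ → ℝ) :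
    binomMean (n + 1) p g =
      (1 - p) * binomMean n p g + p * binomMean n p (fun k => g (k + 1)) := by
  rw [binomMean_eq_antidiagonal, Finset.sum_antidiagonal_choose_succ_mul
    (fun i j => p ^ i * (1 - p) ^ j * g i), binomMean_eq_antidiagonal, binomMean_eq_antidiagonal,
    Finset.mul_sum, Finset.mul_sum]
  congr 1
  · exact Finset.sum_congr rfl fun _ _ => by ring
  · refine Finset.sum_congr rfl fun ij h => ?_
    rw [← Finset.HasAntidiagonal.mem_antidiagonal.1 h, ← Nat.choose_symm_add]
    ring

theorem binomMean_le_binomMean (n : ℕ) {p : ℝ} (h0 : 0 ≤ p) (h1 : p ≤ 1) {g h : ℕ → ℝ}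
    (hgh : ∀ k ≤ n, g k ≤ h k) : binomMean n p g ≤ binomMean n p h :=
  Finset.sum_le_sum fun k hk => mul_le_mul_of_nonneg_left
    (hgh k (Nat.lt_succ_iff.1 (Finset.mem_range.1 hk))) (binomWt_nonneg n h0 h1 k)

theorem binomMean_const (n : ℕ) (p c : ℝ) : binomMean n p (fun _ => c) = c := by
  rw [binomMean, ← Finset.sum_mul, sum_binomWt, one_mul]

theorem binomMean_mono {p : ℝ} (h0 : 0 ≤ p) (h1 : p ≤ 1) {g : ℕ → ℝ} (hg : Monotone g) :
    Monotone fun n => binomMean n p g := by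
  refine monotone_nat_of_le_succ fun n => ?_
  rw [binomMean_succ]
  have := binomMean_le_binomMean n h0 h1 (fun k _ => hg (Nat.le_succ k))
  nlinarith

/-- Reconciles the two descriptions of decoherence: `nodeKernel` counts survivors, whereas `slotWt`
counts losses. -/
theorem binomMean_reflect (n : ℕ) (p : ℝ) (g : ℕ → ℝ) :
    binomMean n (1 - p) g = binomMean n p (fun k => g (n - k)) := by
  unfold binomMean
  rw [← Finset.sum_range_reflect]
  refine Finset.sum_congr rfl fun k hk => ?_
  have hk' : k ≤ n := Nat.lt_succ_iff.1 (Finset.mem_range.1 hk)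
  rw [Nat.add_sub_cancel, binomWt_reflect p hk']

namespace QSwitch

variable {V : Type*}

/-! ### The one-node operators -/

theorem one_sub_mu_mem (s : QSwitch V) (v : V) : 0 ≤ 1 - s.mu v ∧ 1 - s.mu v ≤ 1 :=
  ⟨by linarith [s.mu_lt_one v], by linarith [s.mu_pos v]⟩

theorem bernWt_lam_nonneg (s : QSwitch V) (v : V) (a : Bool) : 0 ≤ bernWt (s.lam v) a :=
  bernWt_nonneg (s.lam_pos v).le (s.lam_lt_one v).le a

/-- The expectation of `g` at the content of the buffer at `v` in the next slot, when it holds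
`n` entanglements after service. -/
def nodeMean (s : QSwitch V) (v : V) (g : ℕ → ℝ) (n : ℕ) : ℝ :=
  ∑ a : Bool, bernWt (s.lam v) a *
    binomMean n (1 - s.mu v) (fun k => g (min (s.buf v) (k + a.toNat)))

theorem sum_nodeKernel_mul (s : QSwitch V) (v : V) (g : ℕ → ℝ) (n : ℕ) :
    ∑ j : Fin (s.buf v + 1), s.nodeKernel v n j * g j = s.nodeMean v g n := by
  unfold nodeKernel nodeMean binomMean
  simp only [Finset.sum_mul, Finset.mul_sum]
  rw [Finset.sum_comm]
  refine Finset.sum_congr rfl fun a _ => ?_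
  rw [Finset.sum_comm]
  refine Finset.sum_congr rfl fun k _ => ?_
  rw [Finset.sum_eq_single_of_mem
    (⟨min (s.buf v) (k + a.toNat), by omega⟩ : Fin (s.buf v + 1)) (Finset.mem_univ _)]
  · simp [mul_assoc]
  · intro j _ hj
    rw [if_neg fun h => hj (Fin.ext h)]
    simp

theorem nodeKernel_nonneg (s : QSwitch V) (v : V) (n j : ℕ) : 0 ≤ s.nodeKernel v n j := by
  refine Finset.sum_nonneg fun a _ => Finset.sum_nonneg fun k _ => mul_nonneg (mul_nonneg
    (s.bernWt_lam_nonneg v a)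
    (binomWt_nonneg n (s.one_sub_mu_mem v).1 (s.one_sub_mu_mem v).2 k)) ?_
  split_ifs <;> norm_num

theorem nodeMean_const (s : QSwitch V) (v : V) (c : ℝ) (n : ℕ) :
    s.nodeMean v (fun _ => c) n = c := by
  simp only [nodeMean, binomMean_const]
  rw [← Finset.sum_mul, sum_bernWt, one_mul]

theorem sum_nodeKernel (s : QSwitch V) (v : V) (n : ℕ) :
    ∑ j : Fin (s.buf v + 1), s.nodeKernel v n j = 1 := by
  have := s.sum_nodeKernel_mul v (fun _ => 1) n
  simpa [nodeMean_const] using this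

theorem nodeMean_mono (s : QSwitch V) (v : V) {g : ℕ → ℝ} (hg : Monotone g) :
    Monotone (s.nodeMean v g) := by
  intro n m hnm
  refine Finset.sum_le_sum fun a _ => mul_le_mul_of_nonneg_left ?_ (s.bernWt_lam_nonneg v a)
  refine binomMean_mono (s.one_sub_mu_mem v).1 (s.one_sub_mu_mem v).2 ?_ hnm
  exact fun i j hij => hg (by omega)

theorem nodeMean_le_nodeMean (s : QSwitch V) (v : V) {g h : ℕ → ℝ} (n : ℕ)
    (hgh : ∀ k ≤ n, ∀ a : Bool,
      g (min (s.buf v) (k + a.toNat)) ≤ h (min (s.buf v) (k + a.toNat))) :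
    s.nodeMean v g n ≤ s.nodeMean v h n :=
  Finset.sum_le_sum fun a _ => mul_le_mul_of_nonneg_left
    (binomMean_le_binomMean n (s.one_sub_mu_mem v).1 (s.one_sub_mu_mem v).2 fun k hk => hgh k hk a)
    (s.bernWt_lam_nonneg v a)

/-- The mean content in the next slot is at most the content after service plus the arrival
rate. -/
theorem nodeMean_id_le (s : QSwitch V) (v : V) (n : ℕ) :
    s.nodeMean v (fun j => (j : ℝ)) n ≤ n + s.lam v := by
  have h : ∀ a : Bool, bernWt (s.lam v) a *
      binomMean n (1 - s.mu v) (fun k => ((min (s.buf v) (k + a.toNat) : ℕ) : ℝ)) ≤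
      bernWt (s.lam v) a * (n + a.toNat) := by
    intro a
    refine mul_le_mul_of_nonneg_left ?_ (s.bernWt_lam_nonneg v a)
    refine (binomMean_le_binomMean n (s.one_sub_mu_mem v).1 (s.one_sub_mu_mem v).2
      (h := fun _ => (n + a.toNat : ℝ)) fun k hk => ?_).trans_eq (binomMean_const _ _ _)
    exact_mod_cast (min_le_right _ _).trans (by omega)
  refine (Finset.sum_le_sum fun a _ => h a).trans_eq ?_
  simp [bernWt]
  ring

/-- One step of the reference chain acting on functions. -/
def refStep (s : QSwitch V) (v : V) (g : ℕ → ℝ) (i : ℕ) : ℝ :=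
  -- Truncated subtraction makes a service attempt on an empty buffer harmless.
  (1 - s.lam v) * s.nodeMean v g i + s.lam v * s.nodeMean v g (i - 1)

theorem sum_refKernel_mul (s : QSwitch V) (v : V) (g : ℕ → ℝ) (i : Fin (s.buf v + 1)) :
    ∑ j, s.refKernel v i j * g j = s.refStep v g i := by
  unfold refKernel refStep
  simp only [Finset.sum_mul, mul_assoc]
  rw [Finset.sum_comm]
  simp only [← Finset.mul_sum, sum_nodeKernel_mul]
  simp [bernWt]
  ring

theorem refKernel_nonneg (s : QSwitch V) (v : V) (i j : Fin (s.buf v + 1)) :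
    0 ≤ s.refKernel v i j :=
  Finset.sum_nonneg fun a _ => mul_nonneg (s.bernWt_lam_nonneg v a) (s.nodeKernel_nonneg v _ _)

theorem sum_refKernel (s : QSwitch V) (v : V) (i : Fin (s.buf v + 1)) :
    ∑ j, s.refKernel v i j = 1 := by
  have := s.sum_refKernel_mul v (fun _ => 1) i
  simpa [refStep, nodeMean_const] using this

/-- Uniqueness of the stationary vector is never needed: only stationarity of the chosen one enters
below. -/
theorem isStationaryVec_refStationary (s : QSwitch V) (v : V) :
    IsStationaryVec (s.refKernel v) (s.refStationary v) :=
  Classical.epsilon_spec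
    (exists_isStationaryVec _ (s.refKernel_nonneg v) (s.sum_refKernel v))

/-! ### Geometric loss of memory of the reference chain. -/

/-- The probability that the reference chain at `v` started at `i` is nonzero after `n` slots. -/
def refPos (s : QSwitch V) (v : V) : ℕ → ℕ → ℝ
  | 0 => fun i => if 0 < i then 1 else 0
  | n + 1 => s.refStep v (s.refPos v n)

/-- Monotonicity in the starting state brackets all starts between `0` and `buf v`, and it is what
the comparison with the true buffer requires. -/
theorem refPos_mono (s : QSwitch V) (v : V) (n : ℕ) : Monotone (s.refPos v n) := by
  induction n with
  | zero =>
    intro i j hij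
    simp only [refPos]
    split_ifs <;> first | omega | norm_num
  | succ n ih =>
    intro i j hij
    simp only [refPos, refStep]
    have h1 := s.nodeMean_mono v ih hij
    have h2 := s.nodeMean_mono v ih (Nat.sub_le_sub_right hij 1)
    have := s.lam_pos v
    have := s.lam_lt_one v
    nlinarith

theorem le_nodeMean (s : QSwitch V) (v : V) {g : ℕ → ℝ} (hg : Monotone g) (n : ℕ) :
    g 0 ≤ s.nodeMean v g n := by
  have h := s.nodeMean_le_nodeMean v (g := fun _ => g 0) (h := g) n
    fun k _ a => hg (Nat.zero_le _)
  rwa [nodeMean_const] at h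

theorem refPos_nonneg (s : QSwitch V) (v : V) (n i : ℕ) : 0 ≤ s.refPos v n i := by
  induction n generalizing i with
  | zero =>
    simp only [refPos]
    split_ifs <;> norm_num
  | succ n ih =>
    have h (j : ℕ) : 0 ≤ s.nodeMean v (s.refPos v n) j :=
      (ih 0).trans (s.le_nodeMean v (s.refPos_mono v n) j)
    exact add_nonneg (mul_nonneg (sub_nonneg.2 (s.lam_lt_one v).le) (h _))
      (mul_nonneg (s.lam_pos v).le (h _))

/-- A lower bound on the one-step probability of emptying a buffer. -/
def emptying (s : QSwitch V) (v : V) : ℝ := (1 - s.lam v) * s.mu v ^ s.buf v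

theorem emptying_pos (s : QSwitch V) (v : V) : 0 < s.emptying v :=
  mul_pos (by linarith [s.lam_lt_one v]) (pow_pos (s.mu_pos v) _)

theorem emptying_le_one (s : QSwitch V) (v : V) : s.emptying v ≤ 1 := by
  have h1 : s.mu v ^ s.buf v ≤ 1 := pow_le_one₀ (s.mu_pos v).le (s.mu_lt_one v).le
  have h2 : 0 < s.mu v ^ s.buf v := pow_pos (s.mu_pos v) _
  unfold emptying
  nlinarith [s.lam_lt_one v, s.lam_pos v]

/-- A Doeblin-type minorization: with probability `(1 - lam v) * mu v ^ n`, at least `emptying v`,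
everything decoheres and nothing arrives; otherwise `g` is bounded by its value at the full buffer.
-/
theorem nodeMean_le_mix (s : QSwitch V) (v : V) {g : ℕ → ℝ} (hg : Monotone g) {n : ℕ}
    (hn : n ≤ s.buf v) :
    s.nodeMean v g n ≤ s.emptying v * g 0 + (1 - s.emptying v) * g (s.buf v) := by
  have hgB : g 0 ≤ g (s.buf v) := hg (Nat.zero_le _)
  have h1 : ∀ a : Bool, binomMean n (1 - s.mu v) (fun k => g (min (s.buf v) (k + a.toNat))) ≤
      g (s.buf v) := fun a =>
    (binomMean_le_binomMean n (s.one_sub_mu_mem v).1 (s.one_sub_mu_mem v).2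
      (h := fun _ => g (s.buf v)) fun k _ => hg (min_le_left _ _)).trans_eq
      (binomMean_const _ _ _)
  have h2 : binomMean n (1 - s.mu v) (fun k => g (min (s.buf v) (k + false.toNat))) ≤
      s.mu v ^ n * g 0 + (1 - s.mu v ^ n) * g (s.buf v) := by
    have hle := binomMean_le_binomMean n (s.one_sub_mu_mem v).1 (s.one_sub_mu_mem v).2
      (g := fun k => g (min (s.buf v) (k + false.toNat)))
      -- This majorant takes the value `g 0` at `k = 0` and `g (buf v)` elsewhere, so its mean only
      -- involves the weight of total loss.
      (h := fun k => g (s.buf v) - if k = 0 then g (s.buf v) - g 0 else 0) (fun k _ => by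
        rcases Nat.eq_zero_or_pos k with rfl | hk
        · simp
        · simpa [hk.ne'] using hg (min_le_left _ _))
    refine hle.trans_eq ?_
    unfold binomMean
    simp only [mul_sub, Finset.sum_sub_distrib, ← Finset.sum_mul, sum_binomWt]
    simp [binomWt]
    ring
  have hpow : s.mu v ^ s.buf v ≤ s.mu v ^ n :=
    pow_le_pow_of_le_one (s.mu_pos v).le (s.mu_lt_one v).le hn
  have hl0 := s.lam_pos v
  have hl1 := s.lam_lt_one v
  calc s.nodeMean v g n = s.lam v * binomMean n (1 - s.mu v)
          (fun k => g (min (s.buf v) (k + true.toNat))) +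
        (1 - s.lam v) * binomMean n (1 - s.mu v)
          (fun k => g (min (s.buf v) (k + false.toNat))) := by simp [nodeMean, bernWt]
    _ ≤ s.lam v * g (s.buf v) +
        (1 - s.lam v) * (s.mu v ^ n * g 0 + (1 - s.mu v ^ n) * g (s.buf v)) :=
      add_le_add (mul_le_mul_of_nonneg_left (h1 _) hl0.le)
        (mul_le_mul_of_nonneg_left h2 (by linarith))
    _ = g (s.buf v) - (1 - s.lam v) * s.mu v ^ n * (g (s.buf v) - g 0) := by ring
    _ ≤ g (s.buf v) - (1 - s.lam v) * s.mu v ^ s.buf v * (g (s.buf v) - g 0) := by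
      have : 0 ≤ (1 - s.lam v) * (g (s.buf v) - g 0) := by
        apply mul_nonneg <;> linarith
      nlinarith
    _ = _ := by unfold emptying; ring

/-- Each slot contracts the gap between the extreme starts by `1 - emptying v`, by `nodeMean_le_mix`
from above and monotonicity from below. -/
theorem refPos_osc (s : QSwitch V) (v : V) (n : ℕ) :
    s.refPos v n (s.buf v) - s.refPos v n 0 ≤ (1 - s.emptying v) ^ n := by
  induction n with
  | zero =>
    simp only [refPos, pow_zero]
    split_ifs <;> norm_num
  | succ n ih =>
    have hm := s.refPos_mono v n
    have h1 := s.nodeMean_le_mix v hm le_rfl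
    have h2 := s.nodeMean_le_mix v hm (Nat.sub_le (s.buf v) 1)
    have h3 := s.le_nodeMean v hm 0
    have hl0 := s.lam_pos v
    have hl1 := s.lam_lt_one v
    have h4 := s.emptying_le_one v
    have hstep : s.refPos v (n + 1) (s.buf v) ≤ s.emptying v * s.refPos v n 0 +
        (1 - s.emptying v) * s.refPos v n (s.buf v) := by
      simp only [refPos, refStep]
      nlinarith
    have hstep0 : s.refPos v n 0 ≤ s.refPos v (n + 1) 0 := by
      simp only [refPos, refStep, Nat.zero_sub]
      nlinarith
    rw [pow_succ]
    nlinarith [mul_le_mul_of_nonneg_right ih (sub_nonneg.2 h4)]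

theorem sum_refStationary_mul_refPos (s : QSwitch V) (v : V) (n : ℕ) :
    ∑ i, s.refStationary v i * s.refPos v n i = s.avail v := by
  obtain ⟨-, hsum, hst⟩ := s.isStationaryVec_refStationary v
  induction n with
  | zero =>
    rw [avail, ← hsum, Fin.sum_univ_succ, Fin.sum_univ_succ]
    simp [refPos]
  | succ n ih =>
    rw [← ih]
    simp only [refPos, ← sum_refKernel_mul, Finset.mul_sum]
    rw [Finset.sum_comm]
    refine Finset.sum_congr rfl fun j _ => ?_
    rw [← hst j, Finset.sum_mul]
    exact Finset.sum_congr rfl fun i _ => by ring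

/-- By stationarity `avail v` is an average of `refPos v n`, hence at most its value at the full
buffer; the oscillation bound transfers this to every start. -/
theorem avail_sub_le_refPos (s : QSwitch V) (v : V) (n i : ℕ) :
    s.avail v - (1 - s.emptying v) ^ n ≤ s.refPos v n i := by
  obtain ⟨h0, hsum, -⟩ := s.isStationaryVec_refStationary v
  have h1 : s.avail v ≤ s.refPos v n (s.buf v) := by
    rw [← s.sum_refStationary_mul_refPos v n]
    calc _ ≤ ∑ i, s.refStationary v i * s.refPos v n (s.buf v) :=
          Finset.sum_le_sum fun i _ => mul_le_mul_of_nonneg_left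
            (s.refPos_mono v n (Nat.lt_succ_iff.1 i.2)) (h0 i)
      _ = _ := by rw [← Finset.sum_mul, hsum, one_mul]
  have h2 := s.refPos_osc v n
  have h3 := s.refPos_mono v n (Nat.zero_le i)
  linarith

end QSwitch

namespace QSwitch

variable {V : Type*}

/-! ### Matchings and service -/

theorem incidentCount_mono (s : QSwitch V) {F F' : Finset s.Edge} (h : F ⊆ F') (v : V) :
    s.incidentCount F v ≤ s.incidentCount F' v := by
  classical
  exact Finset.card_le_card (Finset.filter_subset_filter _ h)

theorem incidentCount_le_one (s : QSwitch V) (m : s.Matching) (v : V) :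
    s.incidentCount m.1 v ≤ 1 := by
  classical
  refine Finset.card_le_one.2 fun e he f hf => ?_
  by_contra hne
  rw [Finset.mem_filter] at he hf
  exact m.2 e he.1 f hf.1 hne v ⟨he.2, hf.2⟩

theorem incidentCount_eq_zero_or (s : QSwitch V) (F : Finset s.Edge) (v : V) :
    s.incidentCount F v = 0 ∨ ∃ e ∈ F, v ∈ e.1 := by
  classical
  rcases Finset.eq_empty_or_nonempty (F.filter (fun e => v ∈ e.1)) with h | ⟨e, he⟩
  · exact Or.inl (by
      unfold incidentCount
      rw [Finset.card_eq_zero]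
      convert h)
  · rw [Finset.mem_filter] at he
    exact Or.inr ⟨e, he⟩

variable [Fintype V]

theorem served_subset (s : QSwitch V) (m : s.Matching) (l : s.LState) (r : s.RState) :
    s.served m l r ⊆ s.potentialServed m l := by
  classical
  exact Finset.filter_subset _ _

theorem mem_potentialServed (s : QSwitch V) (m : s.Matching) (l : s.LState) (e : s.Edge) :
    e ∈ s.potentialServed m l ↔ e ∈ m.1 ∧ ∀ v ∈ e.1, 0 < (l v : ℕ) := by
  classical
  simp [potentialServed]

theorem mem_served (s : QSwitch V) (m : s.Matching) (l : s.LState) (r : s.RState) (e : s.Edge) :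
    e ∈ s.served m l r ↔ e ∈ s.potentialServed m l ∧ 0 < r e := by
  classical
  simp [served]

theorem potentialServed_subset (s : QSwitch V) (m : s.Matching) (l : s.LState) :
    s.potentialServed m l ⊆ m.1 := fun _ h => ((s.mem_potentialServed m l _).1 h).1

/-- Ensures that the truncated subtraction in `polKernel` is a true one, as the flow balance below
needs. -/
theorem incidentCount_potentialServed_le (s : QSwitch V) (m : s.Matching) (l : s.LState) (v : V) :
    s.incidentCount (s.potentialServed m l) v ≤ l v := by
  rcases s.incidentCount_eq_zero_or (s.potentialServed m l) v with h | ⟨e, he, hv⟩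
  · omega
  · have h1 := s.incidentCount_mono (s.potentialServed_subset m l) v
    have h2 := s.incidentCount_le_one m v
    have h3 := ((s.mem_potentialServed m l e).1 he).2 v hv
    omega

open Classical in
/-- A matching has at most `(|S| - 1) / 2` edges inside a vertex set `S` of odd size. -/
theorem card_matching_inside_le (s : QSwitch V) (m : s.Matching) {S : Finset V}
    (hS : Odd S.card) :
    (((m.1.filter fun e => ∀ v ∈ e.1, v ∈ S).card : ℕ) : ℝ) ≤ ((S.card : ℝ) - 1) / 2 := by
  set F := m.1.filter fun e => ∀ v ∈ e.1, v ∈ S with hF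
  have hcard : ∀ e ∈ F, (e.1.toFinset).card = 2 := fun e _ =>
    Sym2.card_toFinset_of_not_isDiag _ (s.G.not_isDiag_of_mem_edgeSet e.2)
  have hdisj : (F : Set s.Edge).PairwiseDisjoint fun e => e.1.toFinset := by
    intro e he f hf hne
    refine Finset.disjoint_left.2 fun v hve hvf => ?_
    rw [Finset.mem_coe, hF, Finset.mem_filter] at he hf
    exact m.2 e he.1 f hf.1 hne v ⟨Sym2.mem_toFinset.1 hve, Sym2.mem_toFinset.1 hvf⟩
  have hsub : F.biUnion (fun e => e.1.toFinset) ⊆ S := by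
    intro v hv
    obtain ⟨e, he, hve⟩ := Finset.mem_biUnion.1 hv
    exact (Finset.mem_filter.1 he).2 v (Sym2.mem_toFinset.1 hve)
  have h := Finset.card_le_card hsub
  rw [Finset.card_biUnion hdisj, Finset.sum_congr rfl hcard, Finset.sum_const, smul_eq_mul] at h
  obtain ⟨k, hk⟩ := hS
  have h' : F.card ≤ k := by omega
  have h'' : (F.card : ℝ) ≤ k := by exact_mod_cast h'
  rw [hk]
  push_cast
  linarith

/-! ### Service rates of request-agnostic policies -/

/-- The expectation of a function of one coordinate under a product kernel. -/
theorem sum_prod_mul_coord {B : V → ℕ} (K : (v : V) → Fin (B v + 1) → ℝ)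
    (hK : ∀ v, ∑ j, K v j = 1) (u : V) (g : Fin (B u + 1) → ℝ)
    [Fintype ((v : V) → Fin (B v + 1))] :
    ∑ l : (v : V) → Fin (B v + 1), (∏ v, K v (l v)) * g (l u) = ∑ j, K u j * g j := by
  classical
  -- Factor `u` carries `g` and all other factors carry 1, so the product of sums collapses to the
  -- sum at `u`.
  have h := Finset.prod_univ_sum (fun _ => Finset.univ)
    (fun v (j : Fin (B v + 1)) => K v j * (if h : v = u then g (h ▸ j) else 1))
  rw [Fintype.piFinset_univ] at h
  have h1 : (∏ v, ∑ j, K v j * (if h : v = u then g (h ▸ j) else 1)) = ∑ j, K u j * g j := by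
    rw [Finset.prod_eq_single u]
    · simp
    · intro v _ hv
      simp [hv, hK]
    · simp
  rw [← h1, h]
  refine Finset.sum_congr (by ext; simp) fun l _ => ?_
  rw [Finset.prod_mul_distrib, Finset.prod_eq_single (f := fun v => dite _ _ _) u]
  · simp
  · intro v _ hv
    simp [hv]
  · simp

theorem sum_polKernel_mul_coord (s : QSwitch V) (pol : s.LState → s.Matching → ℝ) (l : s.LState)
    (v : V) :
    ∑ l', s.polKernel pol l l' * ((l' v : ℕ) : ℝ) =
      ∑ m, pol l m * s.nodeMean v (fun j => (j : ℝ))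
        ((l v : ℕ) - s.incidentCount (s.potentialServed m l) v) := by
  unfold polKernel
  simp only [Finset.sum_mul, mul_assoc]
  rw [Finset.sum_comm]
  simp only [← Finset.mul_sum]
  refine Finset.sum_congr rfl fun m _ => ?_
  rw [sum_prod_mul_coord (B := s.buf) (fun v j => s.nodeKernel v
    ((l v : ℕ) - s.incidentCount (s.potentialServed m l) v) j)
    (fun v => s.sum_nodeKernel v _) v (fun j => ((j : ℕ) : ℝ)),
    s.sum_nodeKernel_mul v (fun j => (j : ℝ))]

/-- In stationarity, a node is served at most at its arrival rate. -/
theorem sum_incidentCount_le_lam (s : QSwitch V) {pol : s.LState → s.Matching → ℝ}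
    {d : s.LState → ℝ} (hpol : s.IsPolicy pol) (hd : IsStationaryVec (s.polKernel pol) d) (v : V) :
    ∑ l, ∑ m, pol l m * d l * (s.incidentCount (s.potentialServed m l) v : ℝ) ≤ s.lam v := by
  obtain ⟨hd0, hd1, hst⟩ := hd
  -- Flow balance: the stationary mean content is unchanged by a slot, and decoherence and
  -- truncation only destroy content, so mean service is at most mean arrivals.
  have h1 : ∑ l, d l * ((l v : ℕ) : ℝ) =
      ∑ l, d l * ∑ m, pol l m * s.nodeMean v (fun j => (j : ℝ))
        ((l v : ℕ) - s.incidentCount (s.potentialServed m l) v) := by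
    simp only [← sum_polKernel_mul_coord, Finset.mul_sum]
    rw [Finset.sum_comm]
    refine Finset.sum_congr rfl fun l' _ => ?_
    rw [← hst l', Finset.sum_mul]
    exact Finset.sum_congr rfl fun l _ => by ring
  have h2 : ∀ l, ∑ m, pol l m * s.nodeMean v (fun j => (j : ℝ))
      ((l v : ℕ) - s.incidentCount (s.potentialServed m l) v) ≤
      ((l v : ℕ) : ℝ) + s.lam v -
        ∑ m, pol l m * (s.incidentCount (s.potentialServed m l) v : ℝ) := by
    intro l
    have : ((l v : ℕ) : ℝ) + s.lam v = ∑ m, pol l m * (((l v : ℕ) : ℝ) + s.lam v) := by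
      rw [← Finset.sum_mul, (hpol l).2, one_mul]
    rw [this, ← Finset.sum_sub_distrib]
    refine Finset.sum_le_sum fun m _ => ?_
    rw [← mul_sub]
    refine mul_le_mul_of_nonneg_left ?_ ((hpol l).1 m)
    refine (s.nodeMean_id_le v _).trans_eq ?_
    rw [Nat.cast_sub (s.incidentCount_potentialServed_le m l v)]
    ring
  have h3 := Finset.sum_le_sum fun l (_ : l ∈ Finset.univ) =>
    mul_le_mul_of_nonneg_left (h2 l) (hd0 l)
  rw [← h1] at h3
  simp only [mul_sub, mul_add, Finset.sum_sub_distrib, Finset.sum_add_distrib, ← Finset.sum_mul,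
    hd1, Finset.mul_sum] at h3
  have h4 : ∑ l, ∑ m, pol l m * d l * (s.incidentCount (s.potentialServed m l) v : ℝ) =
      ∑ l, ∑ m, d l * (pol l m * (s.incidentCount (s.potentialServed m l) v : ℝ)) :=
    Finset.sum_congr rfl fun l _ => Finset.sum_congr rfl fun m _ => by ring
  rw [h4]
  linarith

open Classical in
/-- The rate at which a policy serves the edge `e` when the entanglement queues have law `d`. -/
def serviceRate (s : QSwitch V) (pol : s.LState → s.Matching → ℝ) (d : s.LState → ℝ)
    (e : s.Edge) : ℝ :=
  ∑ l : s.LState with (∀ v ∈ e.1, 0 < (l v : ℕ)), ∑ m : s.Matching with e ∈ m.1, pol l m * d l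

open Classical in
theorem serviceRate_eq (s : QSwitch V) (pol : s.LState → s.Matching → ℝ) (d : s.LState → ℝ)
    (e : s.Edge) : s.serviceRate pol d e =
      ∑ l, ∑ m, pol l m * d l * (if e ∈ s.potentialServed m l then 1 else 0) := by
  unfold serviceRate
  rw [Finset.sum_filter]
  refine Finset.sum_congr rfl fun l _ => ?_
  split_ifs with h
  · rw [Finset.sum_filter]
    refine Finset.sum_congr rfl fun m _ => ?_
    have : e ∈ s.potentialServed m l ↔ e ∈ m.1 := by
      rw [mem_potentialServed, and_iff_left h]
    simp only [this, mul_ite, mul_one, mul_zero]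
  · refine (Finset.sum_eq_zero fun m _ => ?_).symm
    rw [if_neg fun h' => h ((s.mem_potentialServed _ _ _).1 h').2, mul_zero]

open Classical in
-- Turns both families of linear constraints into averages of edge counts in a single served set.
theorem sum_serviceRate (s : QSwitch V) (pol : s.LState → s.Matching → ℝ) (d : s.LState → ℝ)
    (q : s.Edge → Prop) : ∑ e with q e, s.serviceRate pol d e =
      ∑ l, ∑ m, pol l m * d l * (((s.potentialServed m l).filter q).card : ℝ) := by
  simp only [serviceRate_eq]
  rw [Finset.sum_comm]
  refine Finset.sum_congr rfl fun l _ => ?_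
  rw [Finset.sum_comm]
  refine Finset.sum_congr rfl fun m _ => ?_
  rw [← Finset.mul_sum, Finset.sum_boole, Finset.filter_filter]
  congr 3
  ext e
  simp [and_comm]

/-- The service rates of a stationary request-agnostic policy are feasible for the linear
program. -/
theorem lpFeasible_serviceRate (s : QSwitch V) {pol : s.LState → s.Matching → ℝ}
    {d : s.LState → ℝ} (hpol : s.IsPolicy pol) (hd : IsStationaryVec (s.polKernel pol) d) :
    s.LPFeasible (s.serviceRate pol d) := by
  classical
  refine ⟨fun v => ?_, fun S hS _ => ?_, fun e => ?_⟩
  · refine le_trans (le_of_eq ?_) (s.sum_incidentCount_le_lam hpol hd v)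
    convert s.sum_serviceRate pol d (fun e => v ∈ e.1)
    unfold incidentCount
    congr
  -- The blossom inequality holds for each matching, hence for the average.
  · have h := s.sum_serviceRate pol d (fun e => ∀ v ∈ e.1, v ∈ S)
    have h' : ∑ l, ∑ m, pol l m * d l * (((s.potentialServed m l).filter
        fun e => ∀ v ∈ e.1, v ∈ S).card : ℝ) ≤ ∑ l, ∑ m, pol l m * d l * (((S.card : ℝ) - 1) / 2) := by
      refine Finset.sum_le_sum fun l _ => Finset.sum_le_sum fun m _ =>
        mul_le_mul_of_nonneg_left ?_ (mul_nonneg ((hpol l).1 m) (hd.1 l))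
      refine le_trans ?_ (s.card_matching_inside_le m hS)
      exact_mod_cast Finset.card_le_card
        (Finset.filter_subset_filter _ (s.potentialServed_subset m l))
    have h'' : ∑ l, ∑ m, pol l m * d l * (((S.card : ℝ) - 1) / 2) = ((S.card : ℝ) - 1) / 2 := by
      simp only [← Finset.sum_mul, (hpol _).2, one_mul, hd.2.1]
    refine le_trans (le_of_eq ?_) (h'.trans_eq h'')
    convert h
  · rw [serviceRate_eq]
    refine Finset.sum_nonneg fun l _ => Finset.sum_nonneg fun m _ =>
      mul_nonneg (mul_nonneg ((hpol l).1 m) (hd.1 l)) ?_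
    split_ifs <;> norm_num

theorem exists_lpFeasible_of_mem_capacity (s : QSwitch V) {ν : s.Edge → ℝ}
    (hν : ν ∈ s.capacity) : ∃ y, s.LPFeasible y ∧ ∀ e, ν e < y e := by
  obtain ⟨pol, d, hpol, hd, h⟩ := hν
  exact ⟨s.serviceRate pol d, s.lpFeasible_serviceRate hpol hd, h⟩

/-! ### Decompositions -/

theorem IsDecomposition.le_one {s : QSwitch V} {p : s.Matching → ℝ} {x : s.Edge → ℝ}
    (h : s.IsDecomposition p x) (e : s.Edge) : x e ≤ 1 := by
  classical
  rw [← h.2.2 e, ← h.2.1]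
  refine (le_of_eq (by congr)).trans
    (Finset.sum_le_sum_of_subset_of_nonneg (Finset.filter_subset (fun m => e ∈ m.1) _)
      fun m _ _ => h.1 m)

/-- The probability that a vertex is covered by the schedule is at most its arrival rate. -/
theorem IsDecomposition.sum_incidentCount_le {s : QSwitch V} {p : s.Matching → ℝ}
    {x : s.Edge → ℝ} (h : s.IsDecomposition p x) (hx : s.LPFeasible x) (v : V) :
    ∑ m, p m * (s.incidentCount m.1 v : ℝ) ≤ s.lam v := by
  classical
  refine le_trans (le_of_eq ?_) (hx.1 v)
  have hx' : ∀ e, x e = ∑ m, p m * (if e ∈ m.1 then 1 else 0) := by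
    intro e
    rw [← h.2.2 e, Finset.sum_filter]
    exact Finset.sum_congr rfl fun m _ => by simp
  simp only [hx']
  rw [Finset.sum_comm]
  refine Finset.sum_congr rfl fun m _ => ?_
  rw [← Finset.mul_sum, Finset.sum_boole, Finset.filter_filter]
  unfold incidentCount
  congr 3
  ext e
  simp [and_comm]

end QSwitch

/-! ### Binomial and Bernoulli laws -/

/-- The binomial law. -/
def binomLaw (n : ℕ) (p : ℝ) : Measure ℕ :=
  ∑ k ∈ Finset.range (n + 1), ENNReal.ofReal (binomWt n p k) • Measure.dirac k

/-- The Bernoulli law. -/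
def bernLaw (p : ℝ) : Measure Bool := ∑ a : Bool, ENNReal.ofReal (bernWt p a) • Measure.dirac a

theorem lintegral_binomLaw (n : ℕ) (p : ℝ) (f : ℕ → ENNReal) : ∫⁻ k, f k ∂(binomLaw n p) =
    ∑ k ∈ Finset.range (n + 1), ENNReal.ofReal (binomWt n p k) * f k := by
  simp [binomLaw, lintegral_smul_measure]

theorem lintegral_bernLaw (p : ℝ) (f : Bool → ENNReal) : ∫⁻ a, f a ∂(bernLaw p) =
    ∑ a, ENNReal.ofReal (bernWt p a) * f a := by
  simp only [bernLaw, lintegral_finsetSum_measure, lintegral_smul_measure, lintegral_dirac,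
    smul_eq_mul]

theorem binomLaw_singleton (n : ℕ) (p : ℝ) (k : ℕ) :
    binomLaw n p {k} = ENNReal.ofReal (binomWt n p k) := by
  rw [← lintegral_indicator_one (measurableSet_singleton k), lintegral_binomLaw]
  simp only [Set.indicator, Set.mem_singleton_iff, Pi.one_apply, mul_ite, mul_one, mul_zero,
    Finset.sum_ite_eq', Finset.mem_range]
  split_ifs with h
  · rfl
  · rw [binomWt_eq_zero p (by omega), ENNReal.ofReal_zero]

theorem bernLaw_singleton (p : ℝ) (a : Bool) : bernLaw p {a} = ENNReal.ofReal (bernWt p a) := by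
  rw [← lintegral_indicator_one (measurableSet_singleton a), lintegral_bernLaw]
  simp only [Set.indicator, Set.mem_singleton_iff, Pi.one_apply, mul_ite, mul_one, mul_zero,
    Finset.sum_ite_eq', Finset.mem_univ, if_true]

theorem isProbabilityMeasure_binomLaw (n : ℕ) {p : ℝ} (h0 : 0 ≤ p) (h1 : p ≤ 1) :
    IsProbabilityMeasure (binomLaw n p) := by
  constructor
  rw [← lintegral_one, lintegral_binomLaw]
  simp only [mul_one]
  rw [← ENNReal.ofReal_sum_of_nonneg fun k _ => binomWt_nonneg n h0 h1 k, sum_binomWt,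
    ENNReal.ofReal_one]

theorem isProbabilityMeasure_bernLaw {p : ℝ} (h0 : 0 ≤ p) (h1 : p ≤ 1) :
    IsProbabilityMeasure (bernLaw p) := by
  constructor
  rw [← lintegral_one, lintegral_bernLaw]
  simp only [mul_one]
  rw [← ENNReal.ofReal_sum_of_nonneg fun k _ => bernWt_nonneg h0 h1 k, sum_bernWt,
    ENNReal.ofReal_one]

namespace QSwitch

variable {V : Type*}

instance instMeasurableSpaceSlot (s : QSwitch V) : MeasurableSpace s.Slot := ⊤

/-- A slot outcome as a tuple. -/
def slotEquiv (s : QSwitch V) : s.Matching × (V → ℕ) × (V → Bool) × s.RState ≃ s.Slot where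
  toFun y := ⟨y.1, y.2.1, y.2.2.1, y.2.2.2⟩
  invFun x := (x.M, x.D, x.Y, x.A)
  left_inv _ := rfl
  right_inv _ := rfl

/-! ### Histories -/

namespace IsSwitchRun

section History

variable {s : QSwitch V} {Ω : Type*} {L : ℕ → Ω → s.LState} {R : ℕ → Ω → s.RState}
  {X : ℕ → Ω → s.Slot}

/-- The queues up to slot `t` and the outcomes of the slots before `t`. -/
def history (L : ℕ → Ω → s.LState) (R : ℕ → Ω → s.RState) (X : ℕ → Ω → s.Slot) (t : ℕ) (ω : Ω) :
    (Fin (t + 1) → s.LState × s.RState) × (Fin t → s.Slot) :=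
  (fun i => (L i ω, R i ω), fun i => X i ω)

theorem history_eq_iff (t : ℕ) (ω ω' : Ω) : history L R X t ω = history L R X t ω' ↔
    (∀ i ≤ t, L i ω = L i ω' ∧ R i ω = R i ω') ∧ ∀ i < t, X i ω = X i ω' := by
  simp only [history, Prod.mk.injEq, funext_iff, Fin.forall_iff, Nat.lt_succ_iff]

end History

end IsSwitchRun

variable [Fintype V]

instance instCountableSlot (s : QSwitch V) : Countable s.Slot :=
  s.slotEquiv.symm.injective.countable

/-! ### The law of one slot and its comparison with the reference chain. -/

/-- The content of the buffer at `v` after service. -/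
def remaining (s : QSwitch V) (l : s.LState) (r : s.RState) (m : s.Matching) (v : V) : ℕ :=
  (l v : ℕ) - s.incidentCount (s.served m l r) v

/-- The joint law of decoherence, entanglement arrivals and request arrivals in a slot, when the
buffer contents after service are `n`. -/
def envLaw (s : QSwitch V) (law : Measure s.RState) (n : V → ℕ) :
    Measure ((V → ℕ) × (V → Bool) × s.RState) :=
  (Measure.pi fun v => binomLaw (n v) (s.mu v)).prod
    ((Measure.pi fun v => bernLaw (s.lam v)).prod law)

instance instProbBinomLaw (s : QSwitch V) (v : V) (n : ℕ) :
    IsProbabilityMeasure (binomLaw n (s.mu v)) :=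
  isProbabilityMeasure_binomLaw n (s.mu_pos v).le (s.mu_lt_one v).le

instance instProbBernLaw (s : QSwitch V) (v : V) : IsProbabilityMeasure (bernLaw (s.lam v)) :=
  isProbabilityMeasure_bernLaw (s.lam_pos v).le (s.lam_lt_one v).le

/-- The mean of `φ` over the outcome of a slot. -/
def slotMean (s : QSwitch V) (law : Measure s.RState) (p : s.Matching → ℝ)
    (l : s.LState) (r : s.RState) (φ : s.Slot → ENNReal) : ENNReal :=
  ∑ m, ENNReal.ofReal (p m) *
    ∫⁻ y, φ (s.slotEquiv (m, y)) ∂(s.envLaw law (s.remaining l r m))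

/-- Identifies the slot weights with point masses of a product measure, so that independence can be
used through marginals. -/
theorem ofReal_slotWt (s : QSwitch V) (law : Measure s.RState) [IsProbabilityMeasure law]
    {p : s.Matching → ℝ} (hp : ∀ m, 0 ≤ p m) (l : s.LState) (r : s.RState)
    (m : s.Matching) (y : (V → ℕ) × (V → Bool) × s.RState) :
    ENNReal.ofReal (s.slotWt law p l r (s.slotEquiv (m, y))) =
      ENNReal.ofReal (p m) * s.envLaw law (s.remaining l r m) {y} := by
  obtain ⟨D, Y, A⟩ := y
  have hB : ∀ v, 0 ≤ binomWt ((l v : ℕ) - s.incidentCount (s.served m l r) v) (s.mu v) (D v) :=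
    fun v => binomWt_nonneg _ (s.mu_pos v).le (s.mu_lt_one v).le _
  have hY : ∀ v, 0 ≤ bernWt (s.lam v) (Y v) := fun v => s.bernWt_lam_nonneg v _
  rw [envLaw, ← Set.singleton_prod_singleton, Measure.prod_prod, ← Set.singleton_prod_singleton,
    Measure.prod_prod, Measure.pi_singleton, Measure.pi_singleton]
  simp only [slotWt, slotEquiv, Equiv.coe_fn_mk, binomLaw_singleton, bernLaw_singleton, remaining]
  rw [ENNReal.ofReal_mul (mul_nonneg (mul_nonneg (hp m) (Finset.prod_nonneg fun v _ => hB v))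
      (Finset.prod_nonneg fun v _ => hY v)),
    ENNReal.ofReal_mul (mul_nonneg (hp m) (Finset.prod_nonneg fun v _ => hB v)),
    ENNReal.ofReal_mul (hp m), ENNReal.ofReal_prod_of_nonneg fun v _ => hB v,
    ENNReal.ofReal_prod_of_nonneg fun v _ => hY v, ofReal_measureReal, mul_assoc, mul_assoc]

theorem tsum_slotWt_mul (s : QSwitch V) (law : Measure s.RState) [IsProbabilityMeasure law]
    {p : s.Matching → ℝ} (hp : ∀ m, 0 ≤ p m) (l : s.LState) (r : s.RState)
    (φ : s.Slot → ENNReal) :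
    ∑' x, ENNReal.ofReal (s.slotWt law p l r x) * φ x = s.slotMean law p l r φ := by
  rw [← s.slotEquiv.tsum_eq, ENNReal.tsum_prod', tsum_fintype]
  refine Finset.sum_congr rfl fun m _ => ?_
  rw [lintegral_countable', ← ENNReal.tsum_mul_left]
  refine tsum_congr fun y => ?_
  rw [s.ofReal_slotWt law hp]
  ring

theorem slotMean_arrivals (s : QSwitch V) (law : Measure s.RState) [IsProbabilityMeasure law]
    {p : s.Matching → ℝ} (hp : ∀ m, 0 ≤ p m) (hp1 : ∑ m, p m = 1) (l : s.LState) (r : s.RState)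
    (f : s.RState → ENNReal) :
    s.slotMean law p l r (fun x => f x.A) = ∫⁻ a, f a ∂law := by
  have h : ∀ m, ∫⁻ y, f (s.slotEquiv (m, y)).A ∂(s.envLaw law (s.remaining l r m)) =
      ∫⁻ a, f a ∂law := by
    intro m
    exact ((measurePreserving_snd (μ := Measure.pi fun v => bernLaw (s.lam v)) (ν := law)).comp
      (measurePreserving_snd (μ := Measure.pi fun v => binomLaw (s.remaining l r m v) (s.mu v))
        )).lintegral_comp (f := f) (measurable_of_countable f)
  simp only [slotMean, h]
  rw [← Finset.sum_mul, ← ENNReal.ofReal_sum_of_nonneg fun m _ => hp m, hp1, ENNReal.ofReal_one,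
    one_mul]

theorem slotMean_schedule (s : QSwitch V) (law : Measure s.RState) [IsProbabilityMeasure law]
    (p : s.Matching → ℝ) (l : s.LState) (r : s.RState) (f : s.Matching → ENNReal) :
    s.slotMean law p l r (fun x => f x.M) = ∑ m, ENNReal.ofReal (p m) * f m := by
  have (m : s.Matching) : IsProbabilityMeasure (s.envLaw law (s.remaining l r m)) := by
    unfold envLaw
    infer_instance
  simp [slotMean, slotEquiv]

/-- Only the coordinates of decoherence and arrival at `v` matter, so the integral reduces to a
two-factor marginal; reflection then turns losses into survivors. -/
theorem lintegral_envLaw_node (s : QSwitch V) (law : Measure s.RState) [IsProbabilityMeasure law]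
    (n : V → ℕ) (v : V) {g : ℕ → ℝ} (hg : ∀ i, 0 ≤ g i) :
    ∫⁻ y, ENNReal.ofReal (g (min (s.buf v) (n v - y.1 v + (y.2.1 v).toNat))) ∂(s.envLaw law n) =
      ENNReal.ofReal (s.nodeMean v g (n v)) := by
  set F : ℕ → Bool → ENNReal := fun d a =>
    ENNReal.ofReal (g (min (s.buf v) (n v - d + a.toNat))) with hF
  have hmap : MeasurePreserving
      (fun y : (V → ℕ) × (V → Bool) × s.RState => (y.1 v, y.2.1 v)) (s.envLaw law n)
      ((binomLaw (n v) (s.mu v)).prod (bernLaw (s.lam v))) :=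
    (measurePreserving_eval (fun v => binomLaw (n v) (s.mu v)) v).prod
      ((measurePreserving_eval (fun v => bernLaw (s.lam v)) v).comp measurePreserving_fst)
  have h1 := hmap.lintegral_comp (f := fun z => F z.1 z.2) (measurable_of_countable _)
  refine h1.trans ?_
  rw [lintegral_prod _ (measurable_of_countable _).aemeasurable]
  simp only [lintegral_bernLaw, lintegral_binomLaw, hF]
  have hb : ∀ a, 0 ≤ bernWt (s.lam v) a := s.bernWt_lam_nonneg v
  have hB : ∀ k, 0 ≤ binomWt (n v) (s.mu v) k := fun k =>
    binomWt_nonneg _ (s.mu_pos v).le (s.mu_lt_one v).le _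
  simp only [← ENNReal.ofReal_mul (hb _)]
  simp only [← ENNReal.ofReal_sum_of_nonneg fun a (_ : a ∈ Finset.univ) =>
    mul_nonneg (hb a) (hg _), ← ENNReal.ofReal_mul (hB _)]
  rw [← ENNReal.ofReal_sum_of_nonneg fun k _ => mul_nonneg (hB k)
    (Finset.sum_nonneg fun a _ => mul_nonneg (hb a) (hg _))]
  congr 1
  simp only [nodeMean, binomMean_reflect]
  simp only [binomMean, Finset.mul_sum]
  rw [Finset.sum_comm]
  exact Finset.sum_congr rfl fun a _ => Finset.sum_congr rfl fun k _ => by ring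

/-- When a node is scheduled with probability at most its arrival rate, the buffer dominates the
reference chain. -/
theorem refStep_le_slotMean (s : QSwitch V) (law : Measure s.RState) [IsProbabilityMeasure law]
    {p : s.Matching → ℝ} (hp : ∀ m, 0 ≤ p m) (hp1 : ∑ m, p m = 1) (v : V)
    (hv : ∑ m, p m * (s.incidentCount m.1 v : ℝ) ≤ s.lam v) (l : s.LState) (r : s.RState)
    {g : ℕ → ℝ} (hg : ∀ i, 0 ≤ g i) (hmono : Monotone g) :
    ENNReal.ofReal (s.refStep v g (l v)) ≤ s.slotMean law p l r fun x =>
      ENNReal.ofReal (g (min (s.buf v) (s.remaining l r x.M v - x.D v + (x.Y v).toNat))) := by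
  have h1 : s.slotMean law p l r (fun x =>
      ENNReal.ofReal (g (min (s.buf v) (s.remaining l r x.M v - x.D v + (x.Y v).toNat)))) =
      ∑ m, ENNReal.ofReal (p m) *
        ENNReal.ofReal (s.nodeMean v g (s.remaining l r m v)) := by
    refine Finset.sum_congr rfl fun m _ => ?_
    rw [← s.lintegral_envLaw_node law (s.remaining l r m) v hg]
    rfl
  have hnm := s.nodeMean_mono v hmono
  have hn0 : ∀ n, 0 ≤ s.nodeMean v g n := fun n => (hg 0).trans (s.le_nodeMean v hmono n)
  rw [h1]
  simp only [← ENNReal.ofReal_mul (hp _)]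
  rw [← ENNReal.ofReal_sum_of_nonneg fun m _ => mul_nonneg (hp m) (hn0 _)]
  refine ENNReal.ofReal_le_ofReal ?_
  -- `a` is the value without service and `b ≤ a` the value after one removal. The reference chain
  -- pays `a - b` with probability `lam v`; the true buffer pays at most `a - b`, and only when `v`
  -- is covered by the schedule.
  set a := s.nodeMean v g (l v)
  set b := s.nodeMean v g ((l v : ℕ) - 1)
  have hba : b ≤ a := hnm (Nat.sub_le _ _)
  calc s.refStep v g (l v) = a - s.lam v * (a - b) := by simp only [refStep, a, b]; ring
    _ ≤ a - (∑ m, p m * (s.incidentCount m.1 v : ℝ)) * (a - b) := by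
      nlinarith
    _ = ∑ m, p m * (a - (s.incidentCount m.1 v : ℝ) * (a - b)) := by
      simp only [mul_sub, Finset.sum_sub_distrib, ← Finset.sum_mul, hp1, ← mul_assoc]
      ring
    _ ≤ _ := by
      refine Finset.sum_le_sum fun m _ => mul_le_mul_of_nonneg_left ?_ (hp m)
      have hc := s.incidentCount_mono
        ((s.served_subset m l r).trans (s.potentialServed_subset m l)) v
      rcases Nat.le_one_iff_eq_zero_or_eq_one.1 (s.incidentCount_le_one m v) with h0 | h0
      · rw [h0] at hc ⊢
        have : s.remaining l r m v = l v := by unfold remaining; omega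
        rw [this]
        simp [a]
      · rw [h0] at hc ⊢
        have : (l v : ℕ) - 1 ≤ s.remaining l r m v := by unfold remaining; omega
        have := hnm this
        simp only [b, Nat.cast_one, one_mul]
        linarith

/-! ### Disintegration of the run along a frame -/

namespace IsSwitchRun

variable {s : QSwitch V} {law : Measure s.RState} {p : s.RState → s.Matching → ℝ} {T : ℕ}
  {Ω : Type*} [MeasurableSpace Ω] {P : Measure Ω}
  {L : ℕ → Ω → s.LState} {R : ℕ → Ω → s.RState} {X : ℕ → Ω → s.Slot}

theorem measurable_ent (h : s.IsSwitchRun law p T P L R X) (t : ℕ) : Measurable (L t) :=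
  measurable_to_countable' fun l => h.measurable_L t l

theorem measurable_req (h : s.IsSwitchRun law p T P L R X) (t : ℕ) : Measurable (R t) :=
  measurable_to_countable' fun r => h.measurable_R t r

theorem measurable_slot (h : s.IsSwitchRun law p T P L R X) (t : ℕ) : Measurable (X t) :=
  measurable_to_countable' fun x => h.measurable_X t x

theorem measurable_history (h : s.IsSwitchRun law p T P L R X) (t : ℕ) :
    Measurable (history L R X t) := by
  unfold history
  refine Measurable.prodMk (measurable_pi_lambda _ fun i => ?_) (measurable_pi_lambda _ fun i => ?_)
  · exact (h.measurable_ent i).prodMk (h.measurable_req i)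
  · exact h.measurable_slot i

variable [IsProbabilityMeasure P]

theorem measure_history_slot (h : s.IsSwitchRun law p T P L R X) (t : ℕ) (ω' : Ω) (x : s.Slot) :
    P (history L R X t ⁻¹' {history L R X t ω'} ∩ {ω | X t ω = x}) =
      P (history L R X t ⁻¹' {history L R X t ω'}) *
        ENNReal.ofReal (s.slotWt law (p (R (T * (t / T)) ω')) (L t ω') (R t ω') x) := by
  -- The prescribed outcome `x` is written into position `t` of the outcome sequence of `ω'`,
  -- leaving its past intact.
  have h1 := h.law_slot t (fun i => L i ω') (fun i => R i ω')
    (Function.update (fun i => X i ω') t x)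
  have hset : {ω | (∀ i ≤ t, L i ω = L i ω' ∧ R i ω = R i ω') ∧
      ∀ i < t, X i ω = Function.update (fun i => X i ω') t x i} =
      history L R X t ⁻¹' {history L R X t ω'} := by
    ext ω
    simp only [Set.mem_ofPred_eq, Set.mem_preimage, Set.mem_singleton_iff, history_eq_iff]
    refine and_congr_right fun _ => forall₂_congr fun i hi => ?_
    rw [Function.update_of_ne hi.ne]
  have hset' : {ω | (∀ i ≤ t, L i ω = L i ω' ∧ R i ω = R i ω') ∧
      ∀ i < t + 1, X i ω = Function.update (fun i => X i ω') t x i} =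
      history L R X t ⁻¹' {history L R X t ω'} ∩ {ω | X t ω = x} := by
    rw [← hset]
    ext ω
    simp only [Set.mem_ofPred_eq, Set.mem_inter_iff, Nat.forall_lt_succ_right,
      Function.update_self, and_assoc]
  rw [hset, hset', Function.update_self] at h1
  rw [← ofReal_measureReal, h1, ENNReal.ofReal_mul measureReal_nonneg, ofReal_measureReal]

/-- Sums `measure_history_slot` over the countably many histories compatible with the two prescribed
states; the slot weight depends on a history only through these states. -/
theorem measure_state_slot (h : s.IsSwitchRun law p T P L R X) {k t : ℕ} (hkt : k * T ≤ t)
    (htk : t < (k + 1) * T) (l l' : s.LState) (r r' : s.RState) (x : s.Slot) :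
    P ({ω | L (k * T) ω = l ∧ R (k * T) ω = r} ∩ {ω | L t ω = l' ∧ R t ω = r'} ∩
        {ω | X t ω = x}) =
      P ({ω | L (k * T) ω = l ∧ R (k * T) ω = r} ∩ {ω | L t ω = l' ∧ R t ω = r'}) *
        ENNReal.ofReal (s.slotWt law (p r) l' r' x) := by
  set S : Set ((Fin (t + 1) → s.LState × s.RState) × (Fin t → s.Slot)) :=
    {η | η.1 ⟨k * T, Nat.lt_succ_iff.2 hkt⟩ = (l, r) ∧ η.1 ⟨t, Nat.lt_succ_self t⟩ = (l', r')}
    with hS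
  have hfloor : T * (t / T) = k * T := by
    rw [Nat.div_eq_of_lt_le hkt htk, mul_comm]
  have hpre : {ω | L (k * T) ω = l ∧ R (k * T) ω = r} ∩ {ω | L t ω = l' ∧ R t ω = r'} =
      history L R X t ⁻¹' S := by
    ext ω
    simp [hS, history]
  have hmeas := fun η => h.measurable_history t (measurableSet_singleton η)
  have h1 := tsum_measure_preimage_singleton (μ := P) (Set.to_countable S) fun η _ => hmeas η
  have h2 := tsum_measure_preimage_singleton (μ := P.restrict {ω | X t ω = x})
    (Set.to_countable S) fun η _ => hmeas η
  rw [hpre, ← Measure.restrict_apply (h.measurable_history t S.to_countable.measurableSet),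
    ← h1, ← h2, ← ENNReal.tsum_mul_right]
  refine tsum_congr fun ⟨η, hη⟩ => ?_
  rw [Measure.restrict_apply (hmeas η)]
  rcases Set.eq_empty_or_nonempty (history L R X t ⁻¹' {η}) with he | ⟨ω', hω'⟩
  · simp [he]
  · obtain rfl : history L R X t ω' = η := hω'
    obtain ⟨hη1, hη2⟩ := hη
    simp only [history, Prod.mk.injEq] at hη1 hη2
    rw [h.measure_history_slot, hfloor, hη1.2, hη2.1, hη2.2]

/-- The tower property inside a frame: a slot is averaged with the matching law `p r` fixed at the
frame start. Values in `ENNReal` avoid any integrability question. -/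
theorem lintegral_slot (h : s.IsSwitchRun law p T P L R X) [IsProbabilityMeasure law]
    {k t : ℕ} (hkt : k * T ≤ t)
    (htk : t < (k + 1) * T) (l : s.LState) (r : s.RState) (hp : ∀ m, 0 ≤ p r m)
    (φ : s.LState → s.RState → s.Slot → ENNReal) :
    ∫⁻ ω, φ (L t ω) (R t ω) (X t ω) ∂P[|{ω | L (k * T) ω = l ∧ R (k * T) ω = r}] =
      ∫⁻ ω, s.slotMean law (p r) (L t ω) (R t ω) (φ (L t ω) (R t ω))
        ∂P[|{ω | L (k * T) ω = l ∧ R (k * T) ω = r}] := by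
  rw [ProbabilityTheory.cond, lintegral_smul_measure, lintegral_smul_measure]
  congr 1
  set E := {ω | L (k * T) ω = l ∧ R (k * T) ω = r}
  have hZ : Measurable fun ω => (L t ω, R t ω) := (h.measurable_ent t).prodMk (h.measurable_req t)
  have hZX : Measurable fun ω => ((L t ω, R t ω), X t ω) := hZ.prodMk (h.measurable_slot t)
  have e1 := lintegral_map (μ := P.restrict E)
    (f := fun z : (s.LState × s.RState) × s.Slot => φ z.1.1 z.1.2 z.2)
    (measurable_of_countable _) hZX
  have e2 := lintegral_map (μ := P.restrict E)
    (f := fun z : s.LState × s.RState => s.slotMean law (p r) z.1 z.2 (φ z.1 z.2))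
    (measurable_of_countable _) hZ
  rw [← e1, ← e2, lintegral_countable', lintegral_countable', ENNReal.tsum_prod']
  refine tsum_congr fun z => ?_
  rw [← s.tsum_slotWt_mul law hp, ← ENNReal.tsum_mul_right]
  refine tsum_congr fun x => ?_
  rw [Measure.map_apply hZX (measurableSet_singleton _), Measure.map_apply hZ
    (measurableSet_singleton _), Measure.restrict_apply (hZX (measurableSet_singleton _)),
    Measure.restrict_apply (hZ (measurableSet_singleton _))]
  have h3 := h.measure_state_slot hkt htk l z.1 r z.2 x
  have s1 : (fun ω => ((L t ω, R t ω), X t ω)) ⁻¹' {(z, x)} ∩ E =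
      E ∩ {ω | L t ω = z.1 ∧ R t ω = z.2} ∩ {ω | X t ω = x} := by
    ext ω
    simp only [Set.mem_inter_iff, Set.mem_preimage, Set.mem_singleton_iff, Prod.ext_iff,
      Set.mem_ofPred_eq]
    tauto
  have s2 : (fun ω => (L t ω, R t ω)) ⁻¹' {z} ∩ E = E ∩ {ω | L t ω = z.1 ∧ R t ω = z.2} := by
    ext ω
    simp only [Set.mem_inter_iff, Set.mem_preimage, Set.mem_singleton_iff, Prod.ext_iff,
      Set.mem_ofPred_eq]
    tauto
  rw [s1, s2, h3]
  ring

end IsSwitchRun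

end QSwitch

/-! ### Availability and service probabilities within a frame. -/

namespace QSwitch

namespace IsSwitchRun

variable {V : Type*} [Fintype V] {s : QSwitch V} {law : Measure s.RState}
  {p : s.RState → s.Matching → ℝ} {T : ℕ}
  {Ω : Type*} [MeasurableSpace Ω] {P : Measure Ω}
  {L : ℕ → Ω → s.LState} {R : ℕ → Ω → s.RState} {X : ℕ → Ω → s.Slot}

/-- The law of the run given the queues at time `t`. -/
abbrev lawGiven (P : Measure Ω) (L : ℕ → Ω → s.LState) (R : ℕ → Ω → s.RState) (t : ℕ)
    (l : s.LState) (r : s.RState) : Measure Ω :=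
  P[|{ω | L t ω = l ∧ R t ω = r}]

theorem ae_lawGiven (h : s.IsSwitchRun law p T P L R X) (t : ℕ) (l : s.LState) (r : s.RState) :
    ∀ᵐ ω ∂(lawGiven P L R t l r), L t ω = l ∧ R t ω = r :=
  ae_cond_of_forall_mem ((h.measurable_L t l).inter (h.measurable_R t r)) fun _ hω => hω

theorem measurableSet_ent_pos (h : s.IsSwitchRun law p T P L R X) (t : ℕ) (v : V) :
    MeasurableSet {ω | 0 < (L t ω v : ℕ)} :=
  h.measurable_ent t (Set.to_countable {l : s.LState | 0 < (l v : ℕ)}).measurableSet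

theorem measurableSet_served (h : s.IsSwitchRun law p T P L R X) (e : s.Edge) (t : ℕ) :
    MeasurableSet {ω | e ∈ s.served (X t ω).M (L t ω) (R t ω)} :=
  ((h.measurable_ent t).prodMk ((h.measurable_req t).prodMk (h.measurable_slot t)))
    (Set.to_countable {z : s.LState × s.RState × s.Slot |
      e ∈ s.served z.2.2.M z.1 z.2.1}).measurableSet

variable [IsProbabilityMeasure P] [IsProbabilityMeasure law]

theorem map_arrivals (h : s.IsSwitchRun law p T P L R X) {k t : ℕ} (hkt : k * T ≤ t)
    (htk : t < (k + 1) * T) (l : s.LState) (r : s.RState) (hp : ∀ m, 0 ≤ p r m)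
    (hp1 : ∑ m, p r m = 1) (hne : P {ω | L (k * T) ω = l ∧ R (k * T) ω = r} ≠ 0) :
    (lawGiven P L R (k * T) l r).map (fun ω => (X t ω).A) = law := by
  have : IsProbabilityMeasure (lawGiven P L R (k * T) l r) := cond_isProbabilityMeasure hne
  have hA : Measurable fun ω => (X t ω).A :=
    (measurable_of_countable (fun x : s.Slot => x.A)).comp (h.measurable_slot t)
  ext B hB
  rw [← lintegral_indicator_one hB, lintegral_map (measurable_of_countable _) hA,
    h.lintegral_slot hkt htk l r hp (fun _ _ x => B.indicator 1 x.A)]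
  simp only [s.slotMean_arrivals law hp hp1]
  rw [lintegral_const, measure_univ, mul_one, lintegral_indicator_one hB]

/-- A submartingale argument in place of a coupling: each induction step trades one slot of the
reference chain for one slot of the actual run, which can only raise the mean. All `j` slots are
traded when `n = 0`, and `refPos v 0` is the indicator of a nonempty buffer. -/
theorem ofReal_refPos_le_lintegral (h : s.IsSwitchRun law p T P L R X) (k : ℕ)
    (l : s.LState) (r : s.RState) (hp : ∀ m, 0 ≤ p r m)
    (hp1 : ∑ m, p r m = 1) (hne : P {ω | L (k * T) ω = l ∧ R (k * T) ω = r} ≠ 0) (v : V)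
    (hv : ∑ m, p r m * (s.incidentCount m.1 v : ℝ) ≤ s.lam v) (j : ℕ) (hj : j ≤ T) (n : ℕ) :
    ENNReal.ofReal (s.refPos v (j + n) (l v)) ≤
      ∫⁻ ω, ENNReal.ofReal (s.refPos v n (L (k * T + j) ω v)) ∂(lawGiven P L R (k * T) l r) := by
  have : IsProbabilityMeasure (lawGiven P L R (k * T) l r) := cond_isProbabilityMeasure hne
  induction j generalizing n with
  | zero =>
    have h1 : ∫⁻ ω, ENNReal.ofReal (s.refPos v n (L (k * T + 0) ω v))
        ∂(lawGiven P L R (k * T) l r) =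
        ∫⁻ _, ENNReal.ofReal (s.refPos v n (l v)) ∂(lawGiven P L R (k * T) l r) := by
      refine lintegral_congr_ae ?_
      filter_upwards [h.ae_lawGiven (k * T) l r] with ω hω
      rw [add_zero, hω.1]
    rw [h1, lintegral_const, measure_univ, mul_one, zero_add]
  | succ j ih =>
    have ih' := ih (by omega) (n + 1)
    rw [show j + 1 + n = j + (n + 1) by ring]
    refine ih'.trans ?_
    set φ : s.LState → s.RState → s.Slot → ENNReal := fun l' r' x => ENNReal.ofReal (s.refPos v n
      (min (s.buf v) (s.remaining l' r' x.M v - x.D v + (x.Y v).toNat))) with hφ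
    have hsucc : ∀ ω, ENNReal.ofReal (s.refPos v n (L (k * T + (j + 1)) ω v)) =
        φ (L (k * T + j) ω) (R (k * T + j) ω) (X (k * T + j) ω) := by
      intro ω
      rw [← add_assoc, h.L_succ]
      rfl
    rw [lintegral_congr hsucc, h.lintegral_slot (t := k * T + j) (Nat.le_add_right _ _)
      (by rw [add_mul, one_mul]; omega) l r hp φ]
    refine lintegral_mono fun ω => ?_
    exact s.refStep_le_slotMean law hp hp1 v hv _ _ (s.refPos_nonneg v n) (s.refPos_mono v n)

theorem avail_sub_le_real (h : s.IsSwitchRun law p T P L R X) (k : ℕ)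
    (l : s.LState) (r : s.RState) (hp : ∀ m, 0 ≤ p r m)
    (hp1 : ∑ m, p r m = 1) (hne : P {ω | L (k * T) ω = l ∧ R (k * T) ω = r} ≠ 0) (v : V)
    (hv : ∑ m, p r m * (s.incidentCount m.1 v : ℝ) ≤ s.lam v) (j : ℕ) (hj : j ≤ T) :
    s.avail v - (1 - s.emptying v) ^ j ≤
      (lawGiven P L R (k * T) l r).real {ω | 0 < (L (k * T + j) ω v : ℕ)} := by
  have : IsProbabilityMeasure (lawGiven P L R (k * T) l r) := cond_isProbabilityMeasure hne
  refine (s.avail_sub_le_refPos v j (l v)).trans ?_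
  have h1 := h.ofReal_refPos_le_lintegral k l r hp hp1 hne v hv j hj 0
  have hm := h.measurableSet_ent_pos (k * T + j) v
  have h2 : ∫⁻ ω, ENNReal.ofReal (s.refPos v 0 (L (k * T + j) ω v))
      ∂(lawGiven P L R (k * T) l r) =
      (lawGiven P L R (k * T) l r) {ω | 0 < (L (k * T + j) ω v : ℕ)} := by
    rw [← lintegral_indicator_one hm]
    refine lintegral_congr fun ω => ?_
    by_cases hω : 0 < (L (k * T + j) ω v : ℕ)
    · rw [Set.indicator_of_mem (by exact hω)]
      simp only [refPos, if_pos hω, ENNReal.ofReal_one, Pi.one_apply]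
    · rw [Set.indicator_of_notMem (by exact hω)]
      simp only [refPos, if_neg hω, ENNReal.ofReal_zero]
  rw [h2, add_zero, ENNReal.ofReal_le_iff_le_toReal (measure_ne_top _ _)] at h1
  exact h1

/-- The two ends of an edge may be dependent, so only `P(A ∩ B) ≥ P(A) + P(B) - 1` is used.
Positivity of `cohFactor` discards the positive part, and the sum over all nodes makes the error
uniform in the edge. -/
theorem cohFactor_sub_le_real (h : s.IsSwitchRun law p T P L R X) (hΓ : 0 < s.cohFactor) (k : ℕ)
    (l : s.LState) (r : s.RState) (hp : ∀ m, 0 ≤ p r m)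
    (hp1 : ∑ m, p r m = 1) (hne : P {ω | L (k * T) ω = l ∧ R (k * T) ω = r} ≠ 0)
    (hv : ∀ v, ∑ m, p r m * (s.incidentCount m.1 v : ℝ) ≤ s.lam v) (e : s.Edge)
    (j : ℕ) (hj : j ≤ T) :
    s.cohFactor - 2 * ∑ v, (1 - s.emptying v) ^ j ≤
      (lawGiven P L R (k * T) l r).real {ω | ∀ v ∈ e.1, 0 < (L (k * T + j) ω v : ℕ)} := by
  have : IsProbabilityMeasure (lawGiven P L R (k * T) l r) := cond_isProbabilityMeasure hne
  obtain ⟨e, he⟩ := e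
  induction e using Sym2.ind with | _ a b => ?_
  have hnn : ∀ v, 0 ≤ (1 - s.emptying v) ^ j := fun v =>
    pow_nonneg (sub_nonneg.2 (s.emptying_le_one v)) j
  have ha := h.avail_sub_le_real k l r hp hp1 hne a (hv a) j hj
  have hb := h.avail_sub_le_real k l r hp hp1 hne b (hv b) j hj
  have hsa := Finset.single_le_sum (fun v _ => hnn v) (Finset.mem_univ a)
  have hsb := Finset.single_le_sum (fun v _ => hnn v) (Finset.mem_univ b)
  have : Finite s.G.Dart := Finite.of_injective _ (SimpleGraph.Dart.toProd_injective (G := s.G))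
  have hΓle : s.cohFactor ≤ max (s.avail a + s.avail b - 1) 0 :=
    ciInf_le (f := fun d : s.G.Dart => max (s.avail d.fst + s.avail d.snd - 1) 0)
      (Set.finite_range _).bddBelow ⟨(a, b), he⟩
  have hΓ' : s.cohFactor ≤ s.avail a + s.avail b - 1 := by
    rcases le_max_iff.1 hΓle with h | h
    · exact h
    · exact absurd hΓ (not_lt.2 h)
  have hset : {ω | ∀ v ∈ s(a, b), 0 < (L (k * T + j) ω v : ℕ)} =
      {ω | 0 < (L (k * T + j) ω a : ℕ)} ∩ {ω | 0 < (L (k * T + j) ω b : ℕ)} := by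
    ext ω
    simp
  have hm := h.measurableSet_ent_pos (k * T + j)
  have hu := measureReal_union_add_inter (μ := lawGiven P L R (k * T) l r)
    (s := {ω | 0 < (L (k * T + j) ω a : ℕ)}) (hm b)
  have hle := measureReal_le_one (μ := lawGiven P L R (k * T) l r)
    (s := {ω | 0 < (L (k * T + j) ω a : ℕ)} ∪ {ω | 0 < (L (k * T + j) ω b : ℕ)})
  dsimp only
  rw [hset]
  linarith

/-- Given the past, the schedule contains `e` with probability `x e` whatever the buffers are, so
the two probabilities multiply once a request is known to be waiting. -/
theorem mul_real_le_real_served (h : s.IsSwitchRun law p T P L R X) {k t : ℕ} (hkt : k * T ≤ t)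
    (htk : t < (k + 1) * T) (l : s.LState) (r : s.RState) (hp : ∀ m, 0 ≤ p r m)
    (hne : P {ω | L (k * T) ω = l ∧ R (k * T) ω = r} ≠ 0)
    {x : s.Edge → ℝ} (hx : s.IsDecomposition (p r) x) (e : s.Edge)
    (hR : ∀ᵐ ω ∂(lawGiven P L R (k * T) l r), 0 < R t ω e) :
    x e * (lawGiven P L R (k * T) l r).real {ω | ∀ v ∈ e.1, 0 < (L t ω v : ℕ)} ≤
      (lawGiven P L R (k * T) l r).real {ω | e ∈ s.served (X t ω).M (L t ω) (R t ω)} := by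
  classical
  have : IsProbabilityMeasure (lawGiven P L R (k * T) l r) := cond_isProbabilityMeasure hne
  set Q := lawGiven P L R (k * T) l r
  have hm : MeasurableSet {ω | ∀ v ∈ e.1, 0 < (L t ω v : ℕ)} :=
    h.measurable_ent t (Set.to_countable {l : s.LState | ∀ v ∈ e.1, 0 < (l v : ℕ)}).measurableSet
  have hms := h.measurableSet_served e t
  have hx0 : ∑ m, ENNReal.ofReal (p r m) * (if e ∈ m.1 then 1 else 0) = ENNReal.ofReal (x e) := by
    rw [← hx.2.2 e, ENNReal.ofReal_sum_of_nonneg fun m _ => hp m, Finset.sum_filter]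
    exact Finset.sum_congr rfl fun m _ => by simp
  have key : ENNReal.ofReal (x e) * Q {ω | ∀ v ∈ e.1, 0 < (L t ω v : ℕ)} ≤
      Q {ω | e ∈ s.served (X t ω).M (L t ω) (R t ω)} := by
    have h1 := h.lintegral_slot hkt htk l r hp
      (fun l' r' x => if e ∈ s.served x.M l' r' then 1 else 0)
    have h2 : Q {ω | e ∈ s.served (X t ω).M (L t ω) (R t ω)} =
        ∫⁻ ω, (if e ∈ s.served (X t ω).M (L t ω) (R t ω) then 1 else 0) ∂Q := by
      rw [← lintegral_indicator_one hms]
      simp only [Set.indicator, Set.mem_ofPred_eq, Pi.one_apply]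
    rw [h2, h1, ← lintegral_indicator_one hm, ← lintegral_const_mul' _ _ ENNReal.ofReal_ne_top]
    refine lintegral_mono_ae ?_
    filter_upwards [hR] with ω hω
    rw [s.slotMean_schedule law (p r) (L t ω) (R t ω)
      (fun m => if e ∈ s.served m (L t ω) (R t ω) then 1 else 0), ← hx0]
    by_cases hL : ∀ v ∈ e.1, 0 < (L t ω v : ℕ)
    · rw [Set.indicator_of_mem (by exact hL), Pi.one_apply, mul_one]
      refine Finset.sum_le_sum fun m _ => mul_le_mul_right ?_ _
      have : e ∈ s.served m (L t ω) (R t ω) ↔ e ∈ m.1 := by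
        rw [mem_served, mem_potentialServed, and_iff_left hω, and_iff_left hL]
      simp only [this, le_refl]
    · rw [Set.indicator_of_notMem (by exact hL), mul_zero]
      exact zero_le
  have hxe : 0 ≤ x e := by
    rw [← hx.2.2 e]
    exact Finset.sum_nonneg fun m _ => hp m
  have := ENNReal.toReal_mono (measure_ne_top _ _) key
  rwa [ENNReal.toReal_mul, ENNReal.toReal_ofReal hxe] at this

end IsSwitchRun

end QSwitch

/-! ### Drift of the Lyapunov function over a frame. -/

namespace QSwitch

variable {V : Type*} [Fintype V]

/-- A bound on the total transient of the reference chains. -/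
def transient (s : QSwitch V) : ℝ := 2 * ∑ v, (s.emptying v)⁻¹

/-- A geometric series: the loss due to an arbitrary initial buffer state is bounded uniformly in
`T`, hence negligible over long frames. -/
theorem sum_range_transient_le (s : QSwitch V) (T : ℕ) :
    ∑ j ∈ Finset.range T, 2 * ∑ v, (1 - s.emptying v) ^ j ≤ s.transient := by
  rw [transient, ← Finset.mul_sum, Finset.sum_comm]
  refine mul_le_mul_of_nonneg_left (Finset.sum_le_sum fun v _ => ?_) zero_le_two
  have h0 := s.emptying_pos v
  have h1 := s.emptying_le_one v
  rw [← one_div, le_div_iff₀ h0]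
  have h := geom_sum_mul_neg (1 - s.emptying v) T
  rw [sub_sub_cancel] at h
  rw [h]
  linarith [pow_nonneg (sub_nonneg.2 h1) T]

namespace IsSwitchRun

variable {s : QSwitch V} {law : Measure s.RState}
  {p : s.RState → s.Matching → ℝ} {T : ℕ}
  {Ω : Type*} {L : ℕ → Ω → s.LState} {R : ℕ → Ω → s.RState} {X : ℕ → Ω → s.Slot}

open Classical in
/-- The service of edge `e` in slot `t`. -/
def service (L : ℕ → Ω → s.LState) (R : ℕ → Ω → s.RState) (X : ℕ → Ω → s.Slot) (e : s.Edge)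
    (t : ℕ) (ω : Ω) : ℝ :=
  if e ∈ s.served (X t ω).M (L t ω) (R t ω) then 1 else 0

theorem service_nonneg (e : s.Edge) (t : ℕ) (ω : Ω) : 0 ≤ service L R X e t ω := by
  unfold service
  split_ifs <;> norm_num

theorem service_le_one (e : s.Edge) (t : ℕ) (ω : Ω) : service L R X e t ω ≤ 1 := by
  unfold service
  split_ifs <;> norm_num

theorem sum_service_le (e : s.Edge) (t n : ℕ) (ω : Ω) :
    ∑ j ∈ Finset.range n, service L R X e (t + j) ω ≤ n := by
  refine (Finset.sum_le_sum fun j _ => service_le_one e (t + j) ω).trans ?_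
  simp

variable [MeasurableSpace Ω] {P : Measure Ω}

theorem req_succ (h : s.IsSwitchRun law p T P L R X) (e : s.Edge) (t : ℕ) (ω : Ω) :
    (R (t + 1) ω e : ℝ) = R t ω e - service L R X e t ω + (X t ω).A e := by
  rw [h.R_succ]
  unfold service
  split_ifs with he
  · have := ((s.mem_served _ _ _ _).1 he).2
    rw [Nat.cast_add, Nat.cast_sub this]
    norm_num
  · simp

theorem req_add (h : s.IsSwitchRun law p T P L R X) (e : s.Edge) (t n : ℕ) (ω : Ω) :
    (R (t + n) ω e : ℝ) = R t ω e - ∑ j ∈ Finset.range n, service L R X e (t + j) ω +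
      ∑ j ∈ Finset.range n, ((X (t + j) ω).A e : ℝ) := by
  induction n with
  | zero => simp
  | succ n ih =>
    rw [← add_assoc, h.req_succ, ih, Finset.sum_range_succ, Finset.sum_range_succ]
    ring

/-- At most one request per slot leaves the queue, so a long queue never blocks service during a
frame. -/
theorem req_add_pos (h : s.IsSwitchRun law p T P L R X) (e : s.Edge) (t n : ℕ) (ω : Ω)
    (hn : n < R t ω e) : 0 < R (t + n) ω e := by
  have h1 := h.req_add e t n ω
  have h2 := sum_service_le (L := L) (R := R) (X := X) e t n ω
  have h3 : (0 : ℝ) ≤ ∑ j ∈ Finset.range n, ((X (t + j) ω).A e : ℝ) :=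
    Finset.sum_nonneg fun _ _ => Nat.cast_nonneg _
  have h4 : (n : ℝ) < R t ω e := by exact_mod_cast hn
  have : (0 : ℝ) < R (t + n) ω e := by linarith
  exact_mod_cast this

theorem measurable_service (h : s.IsSwitchRun law p T P L R X) (e : s.Edge) (t : ℕ) :
    Measurable (service L R X e t) := by
  unfold service
  exact Measurable.ite (h.measurableSet_served e t) measurable_const measurable_const

theorem memLp_service (h : s.IsSwitchRun law p T P L R X) (Q : Measure Ω) [IsFiniteMeasure Q]
    (e : s.Edge) (t : ℕ) : MemLp (service L R X e t) 2 Q :=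
  MemLp.of_bound (h.measurable_service e t).aestronglyMeasurable 1 (ae_of_all _ fun ω => by
    rw [Real.norm_of_nonneg (service_nonneg e t ω)]
    exact service_le_one e t ω)

theorem integral_service (h : s.IsSwitchRun law p T P L R X) (Q : Measure Ω) [IsFiniteMeasure Q]
    (e : s.Edge) (t : ℕ) :
    ∫ ω, service L R X e t ω ∂Q = Q.real {ω | e ∈ s.served (X t ω).M (L t ω) (R t ω)} := by
  rw [← integral_indicator_one (h.measurableSet_served e t)]
  refine integral_congr_ae (ae_of_all _ fun ω => ?_)
  by_cases hω : e ∈ s.served (X t ω).M (L t ω) (R t ω)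
  · rw [Set.indicator_of_mem (by exact hω), service, if_pos hω, Pi.one_apply]
  · rw [Set.indicator_of_notMem (by exact hω), service, if_neg hω]

/-- The increment of the Lyapunov function over `n` slots. -/
theorem lyap_sub_lyap (h : s.IsSwitchRun law p T P L R X) (t n : ℕ) (ω : Ω) :
    s.lyap (R (t + n) ω) - s.lyap (R t ω) = ∑ e, ((R t ω e : ℝ) *
      (∑ j ∈ Finset.range n, ((X (t + j) ω).A e : ℝ) -
        ∑ j ∈ Finset.range n, service L R X e (t + j) ω) +
      (1 / 2) * (∑ j ∈ Finset.range n, ((X (t + j) ω).A e : ℝ) -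
        ∑ j ∈ Finset.range n, service L R X e (t + j) ω) ^ 2) := by
  simp only [lyap, Finset.mul_sum]
  rw [← Finset.sum_sub_distrib]
  refine Finset.sum_congr rfl fun e _ => ?_
  rw [h.req_add e t n ω]
  ring

variable [IsProbabilityMeasure P]

/-- An edge whose queue cannot empty during the frame is served at least in the proportion of the
coherence factor. -/
theorem le_integral_sum_service [IsProbabilityMeasure law] (h : s.IsSwitchRun law p T P L R X)
    (hΓ : 0 < s.cohFactor) (k : ℕ) (l : s.LState) (r : s.RState)
    (hne : P {ω | L (k * T) ω = l ∧ R (k * T) ω = r} ≠ 0)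
    {x : s.Edge → ℝ} (hx : s.IsDecomposition (p r) x) (hf : s.LPFeasible x) (e : s.Edge)
    (hr : T ≤ r e) :
    x e * (T * s.cohFactor - s.transient) ≤
      ∫ ω, ∑ j ∈ Finset.range T, service L R X e (k * T + j) ω ∂(lawGiven P L R (k * T) l r) := by
  have : IsProbabilityMeasure (lawGiven P L R (k * T) l r) := cond_isProbabilityMeasure hne
  rw [integral_finsetSum _ fun j _ => (h.memLp_service _ e _).integrable one_le_two]
  have hj : ∀ j ∈ Finset.range T, x e * (s.cohFactor - 2 * ∑ v, (1 - s.emptying v) ^ j) ≤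
      ∫ ω, service L R X e (k * T + j) ω ∂(lawGiven P L R (k * T) l r) := by
    intro j hj
    have hjT := Finset.mem_range.1 hj
    rw [h.integral_service]
    refine le_trans (mul_le_mul_of_nonneg_left (h.cohFactor_sub_le_real hΓ k l r hx.1 hx.2.1 hne
      (fun v => hx.sum_incidentCount_le hf v) e j hjT.le) (hf.2.2 e)) ?_
    refine h.mul_real_le_real_served (Nat.le_add_right _ _)
      (by rw [add_mul, one_mul]; omega) l r hx.1 hne hx e ?_
    filter_upwards [h.ae_lawGiven (k * T) l r] with ω hω
    exact h.req_add_pos e _ j ω (by rw [hω.2]; omega)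
  refine le_trans ?_ (Finset.sum_le_sum hj)
  rw [← Finset.mul_sum, Finset.sum_sub_distrib]
  refine mul_le_mul_of_nonneg_left ?_ (hf.2.2 e)
  have := s.sum_range_transient_le T
  simp only [Finset.sum_const, Finset.card_range, nsmul_eq_mul]
  linarith

theorem memLp_arrivals (h : s.IsSwitchRun law p T P L R X) {ν σ : s.Edge → ℝ}
    (hlaw : s.IsArrivalLaw law ν σ) {k t : ℕ} (hkt : k * T ≤ t)
    (htk : t < (k + 1) * T) (l : s.LState) (r : s.RState)
    {x : s.Edge → ℝ} (hx : s.IsDecomposition (p r) x)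
    (hne : P {ω | L (k * T) ω = l ∧ R (k * T) ω = r} ≠ 0) (e : s.Edge) :
    MemLp (fun ω => ((X t ω).A e : ℝ)) 2 (lawGiven P L R (k * T) l r) ∧
    ∫ ω, ((X t ω).A e : ℝ) ∂(lawGiven P L R (k * T) l r) = ν e ∧
    ∫ ω, ((X t ω).A e : ℝ) ^ 2 ∂(lawGiven P L R (k * T) l r) = σ e ^ 2 + ν e ^ 2 := by
  have := hlaw.isProbabilityMeasure
  have hmap := h.map_arrivals hkt htk l r hx.1 hx.2.1 hne
  have hA : Measurable fun ω => (X t ω).A :=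
    (measurable_of_countable (fun x : s.Slot => x.A)).comp (h.measurable_slot t)
  have hm (f : s.RState → ℝ) : AEStronglyMeasurable f
      ((lawGiven P L R (k * T) l r).map fun ω => (X t ω).A) :=
    (measurable_of_countable f).aestronglyMeasurable
  have hL2 := hlaw.memLp e
  refine ⟨?_, ?_, ?_⟩
  · rw [← hmap] at hL2
    exact hL2.comp_of_map hA.aemeasurable
  · rw [← hlaw.mean e, ← hmap, integral_map hA.aemeasurable (hm _)]
  · have hvar := variance_eq_sub hL2
    rw [hlaw.variance e, hlaw.mean e] at hvar
    have : ∫ ω, ((X t ω).A e : ℝ) ^ 2 ∂(lawGiven P L R (k * T) l r) = ∫ a, (a e : ℝ) ^ 2 ∂law := by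
      conv_rhs => rw [← hmap]
      rw [integral_map hA.aemeasurable (hm _)]
    rw [this]
    simp only [Pi.pow_apply] at hvar
    linarith

/-- The drift over a frame, in terms of the linear program solution. -/
theorem integrable_and_integral_lyap_le (h : s.IsSwitchRun law p T P L R X) {ν σ : s.Edge → ℝ}
    (hlaw : s.IsArrivalLaw law ν σ) (hΓ : 0 < s.cohFactor) (k : ℕ) (l : s.LState) (r : s.RState)
    (hne : P {ω | L (k * T) ω = l ∧ R (k * T) ω = r} ≠ 0)
    {x : s.Edge → ℝ} (hx : s.IsDecomposition (p r) x) (hf : s.LPFeasible x)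
    {c : ℝ} (hc : 0 ≤ c) (hcT : T * c ≤ T * s.cohFactor - s.transient) :
    Integrable (fun ω => s.lyap (R ((k + 1) * T) ω) - s.lyap (R (k * T) ω))
        (lawGiven P L R (k * T) l r) ∧
      ∫ ω, (s.lyap (R ((k + 1) * T) ω) - s.lyap (R (k * T) ω)) ∂(lawGiven P L R (k * T) l r) ≤
        ∑ e, (T * (r e * ν e) - T * c * (r e * x e) +
          (T ^ 2 * c + (1 / 2) * (T ^ 2 * (σ e ^ 2 + ν e ^ 2) + T ^ 2))) := by
  have := hlaw.isProbabilityMeasure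
  have : IsProbabilityMeasure (lawGiven P L R (k * T) l r) := cond_isProbabilityMeasure hne
  set Q := lawGiven P L R (k * T) l r
  set a : s.Edge → Ω → ℝ := fun e ω => ∑ j ∈ Finset.range T, ((X (k * T + j) ω).A e : ℝ) with ha
  set b : s.Edge → Ω → ℝ := fun e ω => ∑ j ∈ Finset.range T, service L R X e (k * T + j) ω with hb
  have hA : ∀ e, ∀ j ∈ Finset.range T, _ := fun e j hj =>
    h.memLp_arrivals hlaw (t := k * T + j) (Nat.le_add_right _ _)
      (by have := Finset.mem_range.1 hj; rw [add_mul, one_mul]; omega) l r hx hne e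
  have ha2 : ∀ e, MemLp (a e) 2 Q := fun e => memLp_finsetSum _ fun j hj => (hA e j hj).1
  have hb2 : ∀ e, MemLp (b e) 2 Q := fun e => memLp_finsetSum _ fun j _ => h.memLp_service Q e _
  have hab2 : ∀ e, MemLp (fun ω => a e ω - b e ω) 2 Q := fun e => (ha2 e).sub (hb2 e)
  have hia := fun e => (ha2 e).integrable one_le_two
  have hib := fun e => (hb2 e).integrable one_le_two
  have hiab := fun e => (hab2 e).integrable one_le_two
  have hsq := fun e => (hab2 e).integrable_sq
  have hAsq : ∀ e, ∀ j ∈ Finset.range T, Integrable (fun ω => ((X (k * T + j) ω).A e : ℝ) ^ 2) Q :=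
    fun e j hj => (hA e j hj).1.integrable_sq
  have hterm : ∀ e, Integrable (fun ω => (r e : ℝ) * (a e ω - b e ω) +
      (1 / 2) * (a e ω - b e ω) ^ 2) Q := fun e =>
    ((hiab e).const_mul _).add ((hsq e).const_mul _)
  have hae : (fun ω => s.lyap (R ((k + 1) * T) ω) - s.lyap (R (k * T) ω)) =ᵐ[Q]
      fun ω => ∑ e, ((r e : ℝ) * (a e ω - b e ω) + (1 / 2) * (a e ω - b e ω) ^ 2) := by
    filter_upwards [h.ae_lawGiven (k * T) l r] with ω hω
    rw [add_mul, one_mul, h.lyap_sub_lyap, hω.2]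
  have hint_a : ∀ e, ∫ ω, a e ω ∂Q = T * ν e := by
    intro e
    rw [integral_finsetSum _ fun j hj => (hA e j hj).1.integrable one_le_two,
      Finset.sum_congr rfl fun j hj => (hA e j hj).2.1]
    simp
  have hint_sq : ∀ e, ∫ ω, (a e ω - b e ω) ^ 2 ∂Q ≤ T ^ 2 * (σ e ^ 2 + ν e ^ 2) + T ^ 2 := by
    intro e
    -- Since `a` and `b` are nonnegative, the cross term can be dropped; Cauchy–Schwarz on `a` then
    -- needs only second moments of single slots, not independence across slots.
    have hpt : ∀ ω, (a e ω - b e ω) ^ 2 ≤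
        T * ∑ j ∈ Finset.range T, ((X (k * T + j) ω).A e : ℝ) ^ 2 + T ^ 2 := by
      intro ω
      have h1 : 0 ≤ a e ω := Finset.sum_nonneg fun _ _ => Nat.cast_nonneg _
      have h2 : 0 ≤ b e ω := Finset.sum_nonneg fun _ _ => service_nonneg _ _ _
      have h3 : b e ω ≤ T := sum_service_le _ _ _ _
      have h4 : a e ω ^ 2 ≤ T * ∑ j ∈ Finset.range T, ((X (k * T + j) ω).A e : ℝ) ^ 2 := by
        have := sq_sum_le_card_mul_sum_sq (s := Finset.range T)
          (f := fun j => ((X (k * T + j) ω).A e : ℝ))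
        rwa [Finset.card_range] at this
      nlinarith [mul_nonneg h1 h2]
    have hisum : Integrable (fun ω => ∑ j ∈ Finset.range T, ((X (k * T + j) ω).A e : ℝ) ^ 2) Q :=
      integrable_finsetSum _ fun j hj => hAsq e j hj
    refine (integral_mono (hsq e) ((hisum.const_mul _).add (integrable_const _)) hpt).trans_eq ?_
    rw [integral_add' (hisum.const_mul _) (integrable_const _), integral_const_mul,
      integral_finsetSum _ fun j hj => hAsq e j hj,
      Finset.sum_congr rfl fun j hj => (hA e j hj).2.2]
    simp
    ring
  refine ⟨(integrable_finsetSum _ fun e _ => hterm e).congr hae.symm, ?_⟩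
  rw [integral_congr_ae hae, integral_finsetSum _ fun e _ => hterm e]
  refine Finset.sum_le_sum fun e _ => ?_
  rw [integral_add ((hiab e).const_mul _) ((hsq e).const_mul _), integral_const_mul,
    integral_const_mul, integral_sub (hia e) (hib e), hint_a e]
  -- The term `T ^ 2 * c` pays for short queues: if `r e < T` the service is discarded, and `r e * x
  -- e ≤ T` because `x e ≤ 1`.
  have hbe : (r e : ℝ) * (T * c * x e) - T ^ 2 * c ≤ r e * ∫ ω, b e ω ∂Q := by
    have hx0 := hf.2.2 e
    have hr0 : (0 : ℝ) ≤ r e := Nat.cast_nonneg _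
    have hT0 : (0 : ℝ) ≤ T := Nat.cast_nonneg _
    rcases le_or_gt T (r e) with hr | hr
    · have h1 := h.le_integral_sum_service hΓ k l r hne hx hf e hr
      have h2 : T * c * x e ≤ ∫ ω, b e ω ∂Q :=
        le_trans (by rw [mul_comm]; exact mul_le_mul_of_nonneg_left hcT hx0) h1
      have h3 := mul_le_mul_of_nonneg_left h2 hr0
      have : 0 ≤ (T : ℝ) ^ 2 * c := by positivity
      linarith
    · have h1 : 0 ≤ ∫ ω, b e ω ∂Q := integral_nonneg fun ω =>
        Finset.sum_nonneg fun _ _ => service_nonneg _ _ _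
      have h2 : (r e : ℝ) ≤ T := by exact_mod_cast hr.le
      have h3 : (r e : ℝ) * x e ≤ T * 1 := mul_le_mul h2 (hx.le_one e) hx0 hT0
      have h4 := mul_le_mul_of_nonneg_left h3 (mul_nonneg hT0 hc)
      have h5 := mul_nonneg hr0 h1
      nlinarith
  have := hint_sq e
  linarith

end IsSwitchRun

end QSwitch

end

/-! ### Choice of the frame length and negative drift. -/

theorem theorem1 {V : Type*} [Fintype V] (s : QSwitch V) (ν σ : s.Edge → ℝ) (ε : ℝ) (hε : 0 < ε)
    (hΓ : 0 < s.cohFactor) (hν : ((1 + ε) / s.cohFactor) • ν ∈ s.capacity) :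
    ∃ (T : ℕ) (δ : ℝ) (𝓑 : Set s.RState), 0 < T ∧ 0 < δ ∧ 𝓑.Finite ∧
      ∀ (law : Measure s.RState), s.IsArrivalLaw law ν σ →
      ∀ (p : s.RState → s.Matching → ℝ), s.IsLPRule p →
      ∀ {Ω : Type*} [MeasurableSpace Ω] (P : Measure Ω) [IsProbabilityMeasure P]
        (L : ℕ → Ω → s.LState) (R : ℕ → Ω → s.RState) (X : ℕ → Ω → s.Slot),
        s.IsSwitchRun law p T P L R X →
      ∀ (k : ℕ) (l : s.LState) (r : s.RState),
        P {ω | L (k * T) ω = l ∧ R (k * T) ω = r} ≠ 0 → r ∉ 𝓑 →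
        Integrable (fun ω => s.lyap (R ((k + 1) * T) ω) - s.lyap (R (k * T) ω))
          (P[|{ω | L (k * T) ω = l ∧ R (k * T) ω = r}]) ∧
        ∫ ω, (s.lyap (R ((k + 1) * T) ω) - s.lyap (R (k * T) ω))
          ∂(P[|{ω | L (k * T) ω = l ∧ R (k * T) ω = r}]) ≤ -δ := by
  obtain ⟨y, hy, hνy⟩ := s.exists_lpFeasible_of_mem_capacity hν
  simp only [Pi.smul_apply, smul_eq_mul] at hνy
  -- Finitely many strict inequalities have a common slack.
  obtain ⟨θ, hθ, hθy⟩ : ∃ θ : ℝ, 0 < θ ∧ ∀ e, (1 + ε) / s.cohFactor * ν e + θ ≤ y e := by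
    rcases isEmpty_or_nonempty s.Edge with hE | hE
    · exact ⟨1, one_pos, fun e => hE.elim e⟩
    · obtain ⟨e₀, he₀⟩ := Finite.exists_min fun e => y e - (1 + ε) / s.cohFactor * ν e
      exact ⟨_, sub_pos.2 (hνy e₀), fun e => by linarith [he₀ e]⟩
  -- The service fraction that is guaranteed: multiplying the capacity slack by `c` gives `ν + c θ ≤
  -- c y`, while the gap `Γ - c > 0` is left to absorb the transient.
  set c := s.cohFactor / (1 + ε) with hc
  have hc0 : 0 < c := by positivity
  have hcy : ∀ e, ν e + c * θ ≤ c * y e := by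
    intro e
    have h1 := mul_le_mul_of_nonneg_left (hθy e) hc0.le
    have h2 : c * ((1 + ε) / s.cohFactor * ν e + θ) = ν e + c * θ := by
      rw [hc]
      field_simp
    linarith
  have hcΓ : 0 < s.cohFactor - c := by
    rw [hc, sub_pos, div_lt_iff₀ (by linarith)]
    nlinarith
  -- The transient must be at most frame length times `Γ - c`; the frame used is `T + 1`, which is
  -- positive.
  obtain ⟨T, hT⟩ := exists_nat_ge (s.transient / (s.cohFactor - c))
  have hT' : ((T + 1 : ℕ) : ℝ) * c ≤ ((T + 1 : ℕ) : ℝ) * s.cohFactor - s.transient := by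
    rw [div_le_iff₀ hcΓ] at hT
    push_cast
    linarith
  set N : ℝ := ((T + 1 : ℕ) : ℝ) with hN
  have hN0 : 0 < N := by positivity
  set C : ℝ := ∑ e, (N ^ 2 * c + (1 / 2) * (N ^ 2 * (σ e ^ 2 + ν e ^ 2) + N ^ 2))
  -- `C` collects the terms that do not involve the queues. Outside this set the linear gain `N * (c
  -- * θ) * ∑ r` exceeds `C` by at least `δ = 1`; inside it the total queue length is bounded.
  refine ⟨T + 1, 1, {r | N * (c * θ) * ∑ e, (r e : ℝ) < C + 1}, Nat.succ_pos T, one_pos, ?_, ?_⟩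
  · classical
    obtain ⟨n, hn⟩ := exists_nat_ge ((C + 1) / (N * (c * θ)))
    refine (Set.finite_Icc (0 : s.RState) fun _ => n).subset fun r hr => ⟨fun _ => Nat.zero_le _,
      fun e => ?_⟩
    have h1 : (r e : ℝ) ≤ ∑ e, (r e : ℝ) :=
      Finset.single_le_sum (f := fun e => (r e : ℝ)) (fun _ _ => Nat.cast_nonneg _)
        (Finset.mem_univ e)
    have h2 : ∑ e, (r e : ℝ) < (C + 1) / (N * (c * θ)) := by
      rw [lt_div_iff₀ (by positivity), mul_comm]
      exact hr
    exact_mod_cast h1.trans (h2.le.trans hn)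
  · intro law hlaw p hp Ω _ P _ L R X hrun k l r hne hr
    obtain ⟨x, ⟨hxf, hxopt⟩, hxd⟩ := hp r
    obtain ⟨hint, hle⟩ := hrun.integrable_and_integral_lyap_le hlaw hΓ k l r hne hxd hxf hc0.le hT'
    refine ⟨hint, hle.trans ?_⟩
    have hr' : C + 1 ≤ N * (c * θ) * ∑ e, (r e : ℝ) := not_lt.1 hr
    -- The only use of optimality: the schedule's weight `∑ r x` is at least that of the comparison
    -- point `y`.
    have h1 := hxopt y hy
    have h2 : ∑ e, (r e : ℝ) * ν e + c * θ * ∑ e, (r e : ℝ) ≤ c * ∑ e, (r e : ℝ) * y e := by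
      rw [Finset.mul_sum, Finset.mul_sum, ← Finset.sum_add_distrib]
      refine Finset.sum_le_sum fun e _ => ?_
      have := mul_le_mul_of_nonneg_left (hcy e) (Nat.cast_nonneg (α := ℝ) (r e))
      linarith
    have h3 := mul_le_mul_of_nonneg_left
      (h2.trans (mul_le_mul_of_nonneg_left h1 hc0.le)) hN0.le
    rw [Finset.sum_add_distrib, Finset.sum_sub_distrib, ← Finset.mul_sum, ← Finset.mul_sum]
    linarith
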